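/- A plane rooted multi-edge tree is a plane rooted tree (a rooted tree in which the children of each vertex are linearly ordered) in which every vertex other than the root is joined to its parent by a positive number of parallel edges. Its size is its number of edges, counted with multiplicity, and its height is the maximum distance of a vertex from the root. Let $A_n$ be the (finite) number of plane rooted multi-edge trees of size $n$, and let $H_n$ be the height of a uniformly random plane rooted multi-edge tree of size $n$. Then, as $n\to\infty$, $$\mathbb{E}(H_n)=\frac{2}{\sqrt5}\sqrt{\pi n}-\frac32+O\Bigl(\frac1{\sqrt n}\Bigr)$$ and $$A_n=\frac{5^{n+1/2}}{2\sqrt{\pi n^3}}\Bigl(1+O\Bigl(\frac1n\Bigr)\Bigr).$$ -/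

import Mathlib

open Filter Asymptotics MeasureTheory

/-- Plane rooted multi-edge trees. A tree is given by the ordered (left to right) list of the
children of its root; each entry `(k, t)` consists of the number `k ≥ 1` of parallel edges that
join the root to this child and the subtree `t` rooted at this child. -/
inductive MultiEdgeTree : Type
  | node (children : List (ℕ+ × MultiEdgeTree)) : MultiEdgeTree

namespace MultiEdgeTree

theorem sizeOf_lt_of_mem {c : ℕ+ × MultiEdgeTree} {l : List (ℕ+ × MultiEdgeTree)} (h : c ∈ l) :
    sizeOf c.2 < sizeOf (node l) := by
  have h1 := List.sizeOf_lt_of_mem h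
  rcases c with ⟨k, t⟩
  simp only [Prod.mk.sizeOf_spec, node.sizeOf_spec] at h1 ⊢
  omega

/-- The size of a tree: its number of edges, counted with multiplicity. -/
def size : MultiEdgeTree → ℕ
  | node l => (l.attach.map fun c => (c.1.1 : ℕ) + size c.1.2).sum
termination_by t => sizeOf t
decreasing_by exact sizeOf_lt_of_mem c.2

/-- The height of a tree: the maximum distance of a vertex from the root. -/
def height : MultiEdgeTree → ℕ
  | node l => (l.attach.map fun c => height c.1.2 + 1).foldr max 0
termination_by t => sizeOf t
decreasing_by exact sizeOf_lt_of_mem c.2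

theorem size_node (l : List (ℕ+ × MultiEdgeTree)) :
    size (node l) = (l.map fun c => (c.1 : ℕ) + size c.2).sum := by
  rw [size]
  exact congrArg List.sum
    (List.attach_map_val (l := l) (f := fun c : ℕ+ × MultiEdgeTree => (c.1 : ℕ) + size c.2))

theorem height_node (l : List (ℕ+ × MultiEdgeTree)) :
    height (node l) = (l.map fun c => height c.2 + 1).foldr max 0 := by
  rw [height]
  exact congrArg (List.foldr max 0)
    (List.attach_map_val (l := l) (f := fun c : ℕ+ × MultiEdgeTree => height c.2 + 1))

/-- The set of all plane rooted multi-edge trees with exactly `n` edges. -/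
def ofSize (n : ℕ) : Set MultiEdgeTree := {t | size t = n}

theorem length_le_size (l : List (ℕ+ × MultiEdgeTree)) : l.length ≤ size (node l) := by
  rw [size_node]
  induction l with
  | nil => simp
  | cons c l ih =>
    have := c.1.pos
    simp only [List.length_cons, List.map_cons, List.sum_cons]
    omega

theorem child_le_size {c : ℕ+ × MultiEdgeTree} {l : List (ℕ+ × MultiEdgeTree)} (h : c ∈ l) :
    (c.1 : ℕ) + size c.2 ≤ size (node l) := by
  rw [size_node]
  exact List.single_le_sum (by simp) _ (List.mem_map.2 ⟨c, h, rfl⟩)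

theorem finite_size_le (n : ℕ) : {t : MultiEdgeTree | size t ≤ n}.Finite := by
  induction n with
  | zero =>
    refine (Set.finite_singleton (node [])).subset ?_
    rintro ⟨l⟩ hl
    have h := length_le_size l
    have h0 : l.length = 0 := by
      have : size (node l) ≤ 0 := hl
      omega
    simp [List.length_eq_zero_iff.1 h0]
  | succ n ih =>
    let S : Set (ℕ+ × MultiEdgeTree) := Set.Iic ⟨n + 1, n.succ_pos⟩ ×ˢ {t | size t ≤ n}
    have hS : S.Finite := (Set.finite_Iic _).prod ih
    have : Finite S := hS
    refine ((List.finite_length_le S (n + 1)).image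
      fun l => node (l.map Subtype.val)).subset ?_
    rintro ⟨l⟩ hl
    have hl' : size (node l) ≤ n + 1 := hl
    have hmem : ∀ c ∈ l, c ∈ S := by
      intro c hc
      have h1 := child_le_size hc
      have h2 := c.1.pos
      refine ⟨?_, ?_⟩
      · change (c.1 : ℕ) ≤ n + 1
        omega
      · change size c.2 ≤ n
        omega
    refine ⟨l.attach.map fun c => ⟨c.1, hmem c.1 c.2⟩, ?_, ?_⟩
    · simpa using (length_le_size l).trans hl'
    · simp only [List.map_map, Function.comp_def]
      exact congrArg node (List.attach_map_subtype_val l)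

theorem finite_ofSize (n : ℕ) : (ofSize n).Finite :=
  (finite_size_le n).subset fun _ h => le_of_eq h

theorem nonempty_ofSize (n : ℕ) : (ofSize n).Nonempty := by
  rcases n with _ | n
  · exact ⟨node [], by simp [ofSize, size_node]⟩
  · exact ⟨node [(⟨n + 1, n.succ_pos⟩, node [])], by simp [ofSize, size_node]⟩

/-- The number `A_n` of plane rooted multi-edge trees with `n` edges (a finite set). -/
noncomputable def count (n : ℕ) : ℕ := (ofSize n).ncard

instance : MeasurableSpace MultiEdgeTree := ⊤

instance : MeasurableSingletonClass MultiEdgeTree := ⟨fun _ => trivial⟩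

/-- The law of a uniformly random plane rooted multi-edge tree with `n` edges. -/
noncomputable def uniformLaw (n : ℕ) : Measure MultiEdgeTree :=
  ProbabilityTheory.uniformOn (ofSize n)

instance (n : ℕ) : IsProbabilityMeasure (uniformLaw n) :=
  ProbabilityTheory.isProbabilityMeasure_uniformOn (finite_ofSize n) (nonempty_ofSize n)

/-- The expected height `E(H_n)` of a uniformly random plane rooted multi-edge tree
with `n` edges. -/
noncomputable def expectedHeight (n : ℕ) : ℝ := ∫ t, (height t : ℝ) ∂(uniformLaw n)

end MultiEdgeTree

/-!
Let `w = z / (1 - z)` enumerate the bundles of parallel edges. Splitting off the leftmost child of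
the root shows that the generating functions of the trees of height at most `h` satisfy
`T₀ = 1` and `T_{h+1} = 1 + w T_h T_{h+1}` (`MultiEdgeTree.card_bounded_succ`). The same recursion
governs the ratios of the generating functions of walks on a path with `N - 1` vertices, where
`N = h + 2`. Since the path has the eigenvalues `2 cos (π j / N)`, this gives an exact formula
(`MultiEdgeTree.card_bounded_eq`): up to the factor `8 * 5^(n-1) / π`, the number of trees with `n`
edges and height at most `N - 2` is the trapezoidal sum with `N` panels of the function
`f θ = sin² θ cos² θ ((1 + 4 cos² θ) / 5)^(n-1)` on `[0, π]`. Letting `N` grow, the number of all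
trees is the integral of `f` with the same factor (`MultiEdgeTree.count_eq_spectralMass`).
Summing over the height, `(∫ f) * (E H + 1)` is the sum over `N ≥ 1` of the differences between the
integral of `f` and its trapezoidal sums (`MultiEdgeTree.expectedHeight_eq`); the additional `1`
comes from `N = 1`, where the trapezoidal sum vanishes.

Near `0` the function `f` is close to `θ² exp (-4 n θ² / 5)`, and it is symmetric about `π / 2`. The
difference between `f` and the two Gaussian profiles at `0` and `π` is small together with its
second derivative (`MultiEdgeTree.exists_remainder_le`), so that the trapezoidal rule with an
`L¹` bound on the second derivative makes its total contribution negligible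
(`MultiEdgeTree.exists_sum_trapPi_remainder_le`). The integral of the Gaussian profiles gives the
asymptotics of the number of trees (`MultiEdgeTree.exists_spectralMass`).

With `R = √(4 n / 5)`, the trapezoidal error of a Gaussian profile is, up to a factor and a
negligible tail, the value at `y = N / (π R)` of
`D y = 1 - (4 / √π) ∑_{j ≥ 1} y⁻¹ φ (j / y)`, where `φ x = x² exp (-x²)`
(`exists_gaussBump_defect`). The sum of these values over `N` is evaluated by the trapezoidal rule
once more, now in `y` (`exists_sum_latticeDefect`): the integral of `D` over the half-line is
`1 / √π`, which leads to `√π R = (2 / √5) √(π n)`, and the value `D 0 = 1` at the left end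
contributes `-1/2`. Together with the `1` above this accounts for the constant `-3/2`.
-/

/-! ### Counting trees by size and height -/

namespace MultiEdgeTree

theorem size_node_cons (c : ℕ+ × MultiEdgeTree) (l : List (ℕ+ × MultiEdgeTree)) :
    size (node (c :: l)) = c.1 + size c.2 + size (node l) := by
  simp [size_node]

theorem height_node_cons (c : ℕ+ × MultiEdgeTree) (l : List (ℕ+ × MultiEdgeTree)) :
    height (node (c :: l)) = max (height c.2 + 1) (height (node l)) := by
  simp [height_node]

theorem size_node_nil : size (node []) = 0 := by simp [size_node]

theorem height_node_nil : height (node []) = 0 := by simp [height_node]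

theorem height_le_size (t : MultiEdgeTree) : height t ≤ size t := by
  suffices h : ∀ n, ∀ t : MultiEdgeTree, sizeOf t ≤ n → height t ≤ size t from h _ t le_rfl
  intro n
  induction n with
  | zero => rintro ⟨l⟩ h; simp at h
  | succ n ih =>
    rintro ⟨l⟩ h
    have hl : ∀ l' : List (ℕ+ × MultiEdgeTree), (∀ c ∈ l', c ∈ l) →
        height (node l') ≤ size (node l') := by
      intro l' hl'
      induction l' with
      | nil => simp [height_node_nil]
      | cons c l' ih' =>
        have h1 := ih' fun c hc => hl' c (List.mem_cons_of_mem _ hc)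
        have h2 := ih c.2 (by
          have := sizeOf_lt_of_mem (hl' c List.mem_cons_self)
          omega)
        have h3 := c.1.pos
        rw [height_node_cons, size_node_cons]
        omega
    exact hl l fun _ h => h

open Classical in
/-- The trees with `n` edges and height at most `h`. -/
noncomputable def bounded (h n : ℕ) : Finset MultiEdgeTree :=
  (finite_ofSize n).toFinset.filter fun t => height t ≤ h

theorem mem_bounded {h n : ℕ} {t : MultiEdgeTree} :
    t ∈ bounded h n ↔ size t = n ∧ height t ≤ h := by
  simp [bounded, ofSize]

theorem card_bounded_of_le {h n : ℕ} (hn : n ≤ h) : (bounded h n).card = count n := by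
  rw [count, Set.ncard_eq_toFinset_card _ (finite_ofSize n)]
  congr 1
  ext t
  simp only [mem_bounded, Set.Finite.mem_toFinset, ofSize, Set.mem_ofPred_eq]
  exact ⟨fun h => h.1, fun h => ⟨h, (height_le_size t).trans (by omega)⟩⟩

theorem card_bounded_zero (n : ℕ) : (bounded 0 n).card = if n = 0 then 1 else 0 := by
  have key : ∀ t : MultiEdgeTree, height t ≤ 0 → t = node [] := by
    rintro ⟨_ | ⟨c, l⟩⟩ h
    · rfl
    · rw [height_node_cons] at h
      omega
  split_ifs with hn
  · rw [Finset.card_eq_one]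
    refine ⟨node [], ?_⟩
    ext t
    rw [mem_bounded, Finset.mem_singleton]
    refine ⟨fun h => key t h.2, ?_⟩
    rintro rfl
    exact ⟨by rw [size_node_nil, hn], by rw [height_node_nil]⟩
  · rw [Finset.card_eq_zero, Finset.eq_empty_iff_forall_notMem]
    intro t ht
    rw [mem_bounded] at ht
    have := key t ht.2
    subst this
    rw [size_node_nil] at ht
    omega

/-- Trees other than a single vertex are decomposed into the bundle of edges to the leftmost child
of the root, the subtree at this child, and the rest of the tree. -/
theorem card_bounded_succ (h n : ℕ) :
    (bounded (h + 1) n).card = (if n = 0 then 1 else 0) +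
      ∑ p ∈ Finset.HasAntidiagonal.antidiagonal n, (if p.1 = 0 then 0 else 1) *
        ∑ q ∈ Finset.HasAntidiagonal.antidiagonal p.2,
          (bounded h q.1).card * (bounded (h + 1) q.2).card := by
  classical
  have h1 := Finset.card_filter_add_card_filter_not (s := bounded (h + 1) n)
    (fun t => t = node [])
  rw [← h1]
  congr 1
  · split_ifs with hn
    · rw [Finset.card_eq_one]
      refine ⟨node [], ?_⟩
      ext t
      simp only [Finset.mem_filter, mem_bounded, Finset.mem_singleton]
      refine ⟨fun h => h.2, ?_⟩
      rintro rfl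
      exact ⟨⟨by rw [size_node_nil, hn], by rw [height_node_nil]; omega⟩, rfl⟩
    · rw [Finset.card_eq_zero, Finset.eq_empty_iff_forall_notMem]
      intro t ht
      simp only [Finset.mem_filter, mem_bounded] at ht
      obtain ⟨⟨ht, -⟩, rfl⟩ := ht
      rw [size_node_nil] at ht
      omega
  · let D : Finset (Σ _ : ℕ × ℕ, Σ _ : ℕ × ℕ, MultiEdgeTree × MultiEdgeTree) :=
      ((Finset.HasAntidiagonal.antidiagonal n).filter fun p => p.1 ≠ 0).sigma fun p =>
        (Finset.HasAntidiagonal.antidiagonal p.2).sigma fun q =>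
          bounded h q.1 ×ˢ bounded (h + 1) q.2
    have hD : D.card = ∑ p ∈ Finset.HasAntidiagonal.antidiagonal n, (if p.1 = 0 then 0 else 1) *
        ∑ q ∈ Finset.HasAntidiagonal.antidiagonal p.2,
          (bounded h q.1).card * (bounded (h + 1) q.2).card := by
      simp only [D, Finset.card_sigma, Finset.card_product, Finset.sum_filter]
      refine Finset.sum_congr rfl fun p _ => ?_
      by_cases hp : p.1 = 0 <;> simp [hp]
    rw [← hD]
    symm
    let chl : MultiEdgeTree → List (ℕ+ × MultiEdgeTree) := fun t => match t with | node l => l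
    have hchl : ∀ t, node (chl t) = t := by rintro ⟨l⟩; rfl
    refine Finset.card_bij (fun x _ => node ((x.1.1.toPNat', x.2.2.1) :: chl x.2.2.2)) ?_ ?_ ?_
    · rintro ⟨⟨k, m⟩, ⟨i, j⟩, s, t⟩ hx
      simp only [D, Finset.mem_sigma, Finset.mem_filter, Finset.HasAntidiagonal.mem_antidiagonal,
        Finset.mem_product, mem_bounded] at hx
      obtain ⟨⟨hkm, hk⟩, hij, ⟨hs, hs'⟩, ht, ht'⟩ := hx
      have hk' : (k.toPNat' : ℕ) = k := PNat.toPNat'_coe (Nat.pos_of_ne_zero hk)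
      simp only [Finset.mem_filter, mem_bounded, size_node_cons, height_node_cons, hchl]
      refine ⟨⟨by omega, by omega⟩, by simp⟩
    · rintro ⟨⟨k, m⟩, ⟨i, j⟩, s, t⟩ hx ⟨⟨k', m'⟩, ⟨i', j'⟩, s', t'⟩ hx' he
      simp only [D, Finset.mem_sigma, Finset.mem_filter, Finset.HasAntidiagonal.mem_antidiagonal,
        Finset.mem_product, mem_bounded] at hx hx'
      obtain ⟨⟨hkm, hk⟩, hij, ⟨hs, -⟩, ht, -⟩ := hx
      obtain ⟨⟨hkm', hk'⟩, hij', ⟨hs', -⟩, ht', -⟩ := hx'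
      simp only [node.injEq, List.cons.injEq, Prod.mk.injEq] at he
      obtain ⟨⟨e1, e2⟩, e3⟩ := he
      have e4 : t = t' := by rw [← hchl t, e3, hchl]
      have e5 : k = k' := by
        rw [← PNat.toPNat'_coe (Nat.pos_of_ne_zero hk), e1,
          PNat.toPNat'_coe (Nat.pos_of_ne_zero hk')]
      subst e2 e4 e5
      obtain rfl : i = i' := by omega
      obtain rfl : j = j' := by omega
      obtain rfl : m = m' := by omega
      rfl
    · rintro ⟨_ | ⟨⟨k, s⟩, l⟩⟩ ht
      · simp at ht
      · simp only [Finset.mem_filter, mem_bounded, size_node_cons, height_node_cons] at ht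
        refine ⟨⟨(k, size s + size (node l)), (size s, size (node l)), s, node l⟩, ?_, ?_⟩
        · simp only [D, Finset.mem_sigma, Finset.mem_filter,
            Finset.HasAntidiagonal.mem_antidiagonal,
            Finset.mem_product, mem_bounded]
          refine ⟨⟨by omega, by simp⟩, trivial, ⟨trivial, by omega⟩, trivial, by omega⟩
        · simp [chl]

/-- The expected height is the sum of the tail probabilities. -/
theorem expectedHeight_mul_count {n M : ℕ} (hM : n ≤ M) :
    expectedHeight n * count n =
      ∑ h ∈ Finset.range M, ((count n : ℝ) - ((bounded h n).card : ℝ)) := by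
  classical
  have hfin := finite_ofSize n
  set S := hfin.toFinset with hS
  have hcard : count n = S.card := Set.ncard_eq_toFinset_card _ hfin
  have hpos : 0 < S.card := by
    rw [Finset.card_pos, hS, Set.Finite.toFinset_nonempty]
    exact nonempty_ofSize n
  have h1 : expectedHeight n * count n = ∑ t ∈ S, (height t : ℝ) := by
    rw [expectedHeight, uniformLaw, ProbabilityTheory.uniformOn, ProbabilityTheory.cond,
      integral_smul_measure]
    have e : (ofSize n) = (S : Set MultiEdgeTree) := by simp [hS]
    rw [e, Measure.count_apply_finset, hcard]
    have : ∫ t in (S : Set MultiEdgeTree), (height t : ℝ) ∂Measure.count =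
        ∑ t ∈ S, (height t : ℝ) := by
      have : IsFiniteMeasure (Measure.count.restrict (S : Set MultiEdgeTree)) :=
        ⟨by rw [Measure.restrict_apply_univ, Measure.count_apply_finset]; simp⟩
      have hint : IntegrableOn (fun t : MultiEdgeTree => (height t : ℝ)) S Measure.count := by
        refine Integrable.of_bound (C := n) (Measurable.of_discrete.aestronglyMeasurable)
          (ae_restrict_of_forall_mem (Finset.measurableSet S) fun t ht => ?_)
        have hs : size t = n := by simpa [hS, ofSize] using ht
        simpa [← hs] using height_le_size t
      rw [setIntegral_finset _ hint]
      simp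
    rw [this]
    have hne : (S.card : ℝ) ≠ 0 := by exact_mod_cast hpos.ne'
    rw [ENNReal.toReal_inv, ENNReal.toReal_natCast, smul_eq_mul]
    field_simp
  have h2 : ∀ t ∈ S, (height t : ℝ) =
      ∑ h ∈ Finset.range M, (if height t ≤ h then (0 : ℝ) else 1) := by
    intro t ht
    have hs : size t = n := by simpa [hS, ofSize] using ht
    have hle := height_le_size t
    have e : ∀ h, (if height t ≤ h then (0 : ℝ) else 1) = if h < height t then 1 else 0 := by
      intro h
      by_cases hh : height t ≤ h
      · simp [hh, not_lt.2 hh]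
      · simp [hh, not_le.1 hh]
    simp only [e]
    rw [← Finset.sum_filter, Finset.sum_const, nsmul_eq_mul, mul_one]
    congr 1
    have : Finset.filter (fun h => h < height t) (Finset.range M) = Finset.range (height t) := by
      ext h; simp only [Finset.mem_filter, Finset.mem_range]; omega
    rw [this, Finset.card_range]
  rw [h1, Finset.sum_congr rfl h2, Finset.sum_comm]
  refine Finset.sum_congr rfl fun h _ => ?_
  have h3 : (bounded h n).card = ∑ t ∈ S, if height t ≤ h then 1 else 0 := by
    rw [bounded, Finset.card_filter]
  rw [hcard, h3]
  push_cast
  rw [Finset.card_eq_sum_ones]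
  push_cast
  rw [← Finset.sum_sub_distrib]
  refine Finset.sum_congr rfl fun t _ => ?_
  split_ifs <;> simp

end MultiEdgeTree

/-! ### The spectral formula for the number of trees of bounded height -/

namespace MultiEdgeTree

/-- The series `z / (1 - z)` that enumerates the bundles of parallel edges. -/
noncomputable def bundle : PowerSeries ℝ := PowerSeries.mk fun n => if n = 0 then 0 else 1

/-- The generating function of the trees of height at most `h`. -/
noncomputable def heightSeries (h : ℕ) : PowerSeries ℝ :=
  PowerSeries.mk fun n => ((bounded h n).card : ℝ)

/-- The expansion of `1 / (1 - x z / (1 - z))`. -/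
noncomputable def poleSeries (x : ℝ) : PowerSeries ℝ :=
  PowerSeries.mk fun n => if n = 0 then 1 else x * (1 + x) ^ (n - 1)

theorem heightSeries_zero : heightSeries 0 = 1 := by
  ext n
  rw [heightSeries, PowerSeries.coeff_mk, card_bounded_zero, PowerSeries.coeff_one]
  split_ifs <;> simp

theorem heightSeries_succ (h : ℕ) :
    heightSeries (h + 1) = 1 + bundle * (heightSeries h * heightSeries (h + 1)) := by
  ext n
  rw [heightSeries, PowerSeries.coeff_mk, card_bounded_succ, map_add, PowerSeries.coeff_one,
    PowerSeries.coeff_mul]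
  simp only [PowerSeries.coeff_mul, bundle, heightSeries, PowerSeries.coeff_mk]
  push_cast
  rfl

theorem one_sub_X_mul_bundle : (1 - PowerSeries.X) * bundle = PowerSeries.X := by
  ext n
  rcases n with _ | n
  · simp [bundle]
  · rw [sub_mul, one_mul, map_sub, PowerSeries.coeff_succ_X_mul, PowerSeries.coeff_X]
    simp only [bundle, PowerSeries.coeff_mk]
    rcases n with _ | n <;> simp

theorem poleSeries_eq (x : ℝ) :
    poleSeries x = 1 + PowerSeries.C x * bundle * poleSeries x := by
  have h0 : (1 - PowerSeries.X : PowerSeries ℝ) ≠ 0 := by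
    intro h
    have := congrArg (PowerSeries.coeff 0) h
    simp at this
  have h1 : (1 - PowerSeries.C (1 + x) * PowerSeries.X) * poleSeries x = 1 - PowerSeries.X := by
    ext n
    rcases n with _ | n
    · simp [poleSeries]
    · rw [sub_mul, one_mul, mul_assoc, map_sub, PowerSeries.coeff_C_mul,
        PowerSeries.coeff_succ_X_mul, map_sub, PowerSeries.coeff_X, PowerSeries.coeff_one]
      simp only [poleSeries, PowerSeries.coeff_mk]
      rcases n with _ | n
      · simp
      · simp [pow_succ]; ring
  refine mul_left_cancel₀ h0 ?_
  have h2 : (PowerSeries.C (1 + x) : PowerSeries ℝ) = 1 + PowerSeries.C x := by simp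
  rw [h2] at h1
  linear_combination h1 + (-(PowerSeries.C x * poleSeries x)) * one_sub_X_mul_bundle

end MultiEdgeTree

theorem sum_cos_eq_zero {N k : ℕ} (hk : 0 < k) (hkN : k < 2 * N) :
    ∑ j ∈ Finset.range (2 * N), Real.cos (k * (Real.pi * j / N)) = 0 := by
  have hN : 0 < N := by omega
  have hζ := Complex.isPrimitiveRoot_exp (2 * N) (by omega)
  set ζ := Complex.exp (2 * Real.pi * Complex.I / ((2 * N : ℕ) : ℂ)) with hζd
  have h1 : ζ ^ k ≠ 1 := hζ.pow_ne_one_of_pos_of_lt hk.ne' hkN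
  have h2 : ∑ j ∈ Finset.range (2 * N), (ζ ^ k) ^ j = 0 := by
    rw [geom_sum_eq h1, ← pow_mul, mul_comm k, pow_mul, hζ.pow_eq_one, one_pow, sub_self, zero_div]
  have h3 := congrArg Complex.re h2
  rw [Complex.re_sum, Complex.zero_re] at h3
  rw [← h3]
  refine Finset.sum_congr rfl fun j _ => ?_
  rw [hζd, ← Complex.exp_nat_mul, ← Complex.exp_nat_mul]
  have hN' : (N : ℂ) ≠ 0 := by exact_mod_cast hN.ne'
  have e : (j : ℂ) * (k * (2 * Real.pi * Complex.I / ((2 * N : ℕ) : ℂ)))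
      = ((k * (Real.pi * j / N) : ℝ) : ℂ) * Complex.I := by
    push_cast
    field_simp
  rw [e, Complex.exp_ofReal_mul_I_re]

/-- `N` times the number of walks of `t` steps from level `0` to level `l` on the path with the
`N - 1` levels `0, …, N - 2`, in spectral form. The sum runs over a full period of `2 N` nodes, so
that it consists of sums of powers of roots of unity. -/
noncomputable def pathMoment (N l t : ℕ) : ℝ :=
  ∑ j ∈ Finset.range (2 * N), Real.sin (Real.pi * j / N) * Real.sin ((l + 1) * (Real.pi * j / N))
    * (2 * Real.cos (Real.pi * j / N)) ^ t

theorem sin_mul_sin_eq (l : ℝ) (θ : ℝ) :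
    Real.sin θ * Real.sin ((l + 1) * θ) = (Real.cos (l * θ) - Real.cos ((l + 2) * θ)) / 2 := by
  have e1 : l * θ = (l + 1) * θ - θ := by ring
  have e2 : (l + 2) * θ = (l + 1) * θ + θ := by ring
  rw [e1, e2, Real.cos_sub, Real.cos_add]
  ring

theorem two_cos_mul_sin (l θ : ℝ) :
    Real.sin ((l + 1) * θ) * (2 * Real.cos θ) = Real.sin ((l + 2) * θ) + Real.sin (l * θ) := by
  have e1 : l * θ = (l + 1) * θ - θ := by ring
  have e2 : (l + 2) * θ = (l + 1) * θ + θ := by ring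
  rw [e1, e2, Real.sin_sub, Real.sin_add]
  ring

/-- A walk needs at least `l` steps to climb to level `l`. -/
theorem pathMoment_eq_zero {N : ℕ} (t : ℕ) : ∀ l : ℕ, t < l → l + t + 2 < 2 * N →
    pathMoment N l t = 0 := by
  induction t with
  | zero =>
    intro l hl hN
    have h1 := sum_cos_eq_zero (N := N) (k := l) hl (by omega)
    have h2 := sum_cos_eq_zero (N := N) (k := l + 2) (by omega) (by omega)
    simp only [pathMoment, pow_zero, mul_one, sin_mul_sin_eq]
    rw [← Finset.sum_div, Finset.sum_sub_distrib, h1]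
    push_cast at h2
    rw [h2]
    simp
  | succ t ih =>
    intro l hl hN
    obtain ⟨m, rfl⟩ : ∃ m, l = m + 1 := ⟨l - 1, by omega⟩
    have h1 := ih (m + 2) (by omega) (by omega)
    have h2 := ih m (by omega) (by omega)
    have : pathMoment N (m + 1) (t + 1) = pathMoment N (m + 2) t + pathMoment N m t := by
      simp only [pathMoment]
      rw [← Finset.sum_add_distrib]
      refine Finset.sum_congr rfl fun j _ => ?_
      have := two_cos_mul_sin ((m : ℝ) + 1) (Real.pi * j / N)
      push_cast
      have e : ((m : ℝ) + 2 + 1) = m + 1 + 2 := by ring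
      rw [e, pow_succ]
      linear_combination (Real.sin (Real.pi * j / N) * (2 * Real.cos (Real.pi * j / N)) ^ t) * this
    rw [this, h1, h2, add_zero]

theorem pathMoment_zero_zero {N : ℕ} (hN : 2 ≤ N) : pathMoment N 0 0 = N := by
  have h2 := sum_cos_eq_zero (N := N) (k := 2) (by omega) (by omega)
  have : pathMoment N 0 0 = ∑ j ∈ Finset.range (2 * N),
      ((1 : ℝ) - Real.cos ((2 : ℕ) * (Real.pi * j / N))) / 2 := by
    simp only [pathMoment]
    refine Finset.sum_congr rfl fun j _ => ?_
    have := sin_mul_sin_eq 0 (Real.pi * j / N)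
    simp only [zero_add, zero_mul, one_mul, Real.cos_zero] at this
    simp [this]
  rw [this, ← Finset.sum_div, Finset.sum_sub_distrib, h2]
  simp

namespace MultiEdgeTree

/-- `N` times the generating function of the walks from level `0` to level `l` on the path with
`N - 1` vertices, in spectral form: a walk of `l + 2 i` steps has the weight `bundle ^ i`. -/
noncomputable def levelSeries (N l : ℕ) : PowerSeries ℝ :=
  ∑ j ∈ Finset.range (2 * N), PowerSeries.C (Real.sin (Real.pi * j / N)
    * Real.sin ((l + 1) * (Real.pi * j / N)) * (2 * Real.cos (Real.pi * j / N)) ^ l)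
    * poleSeries ((2 * Real.cos (Real.pi * j / N)) ^ 2)

theorem levelSeries_zero {N : ℕ} (hN : 2 ≤ N) :
    levelSeries N 0 = PowerSeries.C (N : ℝ) + bundle * levelSeries N 1 := by
  rw [← pathMoment_zero_zero hN]
  simp only [levelSeries, pathMoment]
  rw [map_sum, Finset.mul_sum, ← Finset.sum_add_distrib]
  refine Finset.sum_congr rfl fun j _ => ?_
  set θ := Real.pi * j / N
  have h := two_cos_mul_sin 0 θ
  simp only [zero_add, one_mul, zero_mul, Real.sin_zero, add_zero] at h
  have h2 : ((1 : ℕ) : ℝ) + 1 = 2 := by norm_num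
  rw [h2, ← h]
  nth_rw 1 [poleSeries_eq]
  simp only [map_mul, map_pow, pow_zero, pow_one, mul_one, Nat.cast_zero, zero_add, one_mul]
  ring

/-- The path recursion; the term that a shift of the expansion of `poleSeries` leaves over is a
`pathMoment` that vanishes. -/
theorem levelSeries_succ {N l : ℕ} (hl : l + 2 < N) :
    levelSeries N (l + 1) = bundle * levelSeries N (l + 2) + levelSeries N l := by
  have h0 := congrArg PowerSeries.C (pathMoment_eq_zero (N := N) l (l + 2) (by omega) (by omega))
  rw [pathMoment, map_sum, map_zero] at h0
  rw [← add_zero (_ * _ + _), ← h0]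
  simp only [levelSeries]
  rw [Finset.mul_sum, ← Finset.sum_add_distrib, ← Finset.sum_add_distrib]
  refine Finset.sum_congr rfl fun j _ => ?_
  set θ := Real.pi * j / N
  have h := two_cos_mul_sin ((l : ℝ) + 1) θ
  push_cast
  have e : (l : ℝ) + 1 + 2 = l + 2 + 1 := by ring
  have e' : (l : ℝ) + 1 + 1 = l + 2 := by ring
  rw [e, e'] at h
  rw [e', eq_sub_of_add_eq h.symm]
  set p := poleSeries ((2 * Real.cos θ) ^ 2) with hp
  have hp' : p = 1 + PowerSeries.C ((2 * Real.cos θ) ^ 2) * bundle * p := poleSeries_eq _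
  simp only [map_mul, map_pow, map_sub] at hp' ⊢
  linear_combination (PowerSeries.C (Real.sin θ) * PowerSeries.C (Real.sin ((l + 2) * θ)) *
    (PowerSeries.C 2 * PowerSeries.C (Real.cos θ)) ^ (l + 1) -
    PowerSeries.C (Real.sin θ) * PowerSeries.C (Real.sin ((l + 1) * θ)) *
    (PowerSeries.C 2 * PowerSeries.C (Real.cos θ)) ^ l) * hp'

theorem levelSeries_top {N : ℕ} (hN : 1 ≤ N) : levelSeries N (N - 1) = 0 := by
  refine Finset.sum_eq_zero fun j _ => ?_
  have hN' : (N : ℝ) ≠ 0 := by exact_mod_cast (by omega : N ≠ 0)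
  have e : (((N - 1 : ℕ) : ℝ) + 1) * (Real.pi * j / N) = j * Real.pi := by
    rw [Nat.cast_sub hN]; field_simp; push_cast; ring
  rw [e, Real.sin_nat_mul_pi]
  simp

/-- Both sides obey the same recursion, started at the end of the path. -/
theorem levelSeries_succ_eq_mul {N : ℕ} (m : ℕ) : ∀ l : ℕ, l + 3 + m = N →
    levelSeries N (l + 1) = heightSeries m * levelSeries N l := by
  induction m with
  | zero =>
    intro l hl
    have h := levelSeries_top (N := N) (by omega)
    have e : N - 1 = l + 2 := by omega
    rw [e] at h
    rw [levelSeries_succ (by omega), h, heightSeries_zero]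
    ring
  | succ m ih =>
    intro l hl
    have h1 := levelSeries_succ (N := N) (l := l) (by omega)
    have h2 := ih (l + 1) (by omega)
    have h3 := heightSeries_succ m
    rw [show l + 1 + 1 = l + 2 from rfl] at h2
    rw [h2] at h1
    linear_combination heightSeries (m + 1) * h1 - levelSeries N (l + 1) * h3

theorem levelSeries_zero_eq {N : ℕ} (hN : 2 ≤ N) :
    levelSeries N 0 = PowerSeries.C (N : ℝ) * heightSeries (N - 2) := by
  have h1 := levelSeries_zero hN
  rcases hN.eq_or_lt with rfl | hN
  · have h := levelSeries_top (N := 2) (by norm_num)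
    rw [show 2 - 1 = 1 from rfl] at h
    rw [h1, h, heightSeries_zero]
    ring
  · obtain ⟨m, rfl⟩ : ∃ m, N = 0 + 3 + m := ⟨N - 3, by omega⟩
    have h2 := levelSeries_succ_eq_mul m 0 rfl
    have h3 := heightSeries_succ m
    rw [show 0 + 3 + m - 2 = m + 1 by omega]
    rw [show 0 + 1 = 1 from rfl] at h2
    rw [h2] at h1
    linear_combination heightSeries (m + 1) * h1 - levelSeries (0 + 3 + m) 0 * h3

/-- The normalized spectral density `sin² θ cos² θ ((1 + 4 cos² θ) / 5)^(n-1)`. -/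
noncomputable def spectral (n : ℕ) (θ : ℝ) : ℝ :=
  Real.sin θ ^ 2 * Real.cos θ ^ 2 * ((1 + 4 * Real.cos θ ^ 2) / 5) ^ (n - 1)

/-- The number of trees of height at most `N - 2` is a Riemann sum of the spectral density. -/
theorem card_bounded_eq {N n : ℕ} (hN : 2 ≤ N) (hn : 1 ≤ n) :
    ((bounded (N - 2) n).card : ℝ) =
      8 * 5 ^ (n - 1) / N * ∑ j ∈ Finset.range N, spectral n (Real.pi * j / N) := by
  have hN' : (N : ℝ) ≠ 0 := by exact_mod_cast (by omega : N ≠ 0)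
  have h := congrArg (PowerSeries.coeff n) (levelSeries_zero_eq hN)
  rw [PowerSeries.coeff_C_mul, heightSeries, PowerSeries.coeff_mk, levelSeries, map_sum] at h
  have e : ∀ j : ℕ, (PowerSeries.coeff n) (PowerSeries.C (Real.sin (Real.pi * j / N)
      * Real.sin (((0 : ℕ) + 1) * (Real.pi * j / N)) * (2 * Real.cos (Real.pi * j / N)) ^ 0)
      * poleSeries ((2 * Real.cos (Real.pi * j / N)) ^ 2))
      = 4 * 5 ^ (n - 1) * spectral n (Real.pi * j / N) := by
    intro j
    rw [PowerSeries.coeff_C_mul, poleSeries, PowerSeries.coeff_mk, if_neg (by omega), spectral,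
      div_pow]
    have : (5 : ℝ) ^ (n - 1) ≠ 0 := by positivity
    have e2 : 1 + (2 * Real.cos (Real.pi * j / N)) ^ 2 =
        1 + 4 * Real.cos (Real.pi * j / N) ^ 2 := by
      ring
    rw [e2]
    simp only [Nat.cast_zero, zero_add, one_mul]
    field_simp
    ring
  simp only [e] at h
  rw [← Finset.mul_sum, two_mul, Finset.sum_range_add] at h
  have e3 : ∀ j : ℕ, spectral n (Real.pi * ((N + j : ℕ) : ℝ) / N) =
      spectral n (Real.pi * j / N) := by
    intro j
    have : Real.pi * ((N + j : ℕ) : ℝ) / N = Real.pi * j / N + Real.pi := by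
      push_cast; field_simp; ring
    rw [this, spectral, spectral, Real.sin_add_pi, Real.cos_add_pi]
    simp
  simp only [e3] at h
  field_simp
  linear_combination -h

end MultiEdgeTree

/-! ### The trapezoidal rule with an integral error bound -/

/-- On one panel, the error of the trapezoidal rule is the integral of the second derivative
against the Peano kernel `(x - a) (b - x) / 2`, which is at most `(b - a)² / 8`. -/
theorem abs_trapezoid_panel_sub_integral_le {f f' f'' : ℝ → ℝ} (hf : ∀ x, HasDerivAt f (f' x) x)
    (hf' : ∀ x, HasDerivAt f' (f'' x) x) (hc : Continuous f'') {a b : ℝ} (hab : a ≤ b) :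
    |(b - a) * ((f a + f b) / 2) - ∫ x in a..b, f x| ≤
      (b - a) ^ 2 / 8 * ∫ x in a..b, |f'' x| := by
  have cf : Continuous f := continuous_iff_continuousAt.2 fun x => (hf x).continuousAt
  have cf' : Continuous f' := continuous_iff_continuousAt.2 fun x => (hf' x).continuousAt
  have hu : ∀ x : ℝ, HasDerivAt (fun x => (x - a) * (b - x) / 2) ((a + b) / 2 - x) x := by
    intro x
    refine ((((hasDerivAt_id' x).sub_const a).mul
      ((hasDerivAt_id' x).const_sub b)).div_const 2).congr_deriv ?_
    ring
  have hu' : ∀ x : ℝ, HasDerivAt (fun x => (a + b) / 2 - x) (-1) x := fun x =>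
    (hasDerivAt_id x).const_sub _
  have h1 := intervalIntegral.integral_mul_deriv_eq_deriv_mul (a := a) (b := b)
    (fun x _ => hu x) (fun x _ => hf' x)
    ((by fun_prop : Continuous fun x : ℝ => (a + b) / 2 - x).intervalIntegrable _ _)
    (hc.intervalIntegrable _ _)
  have h2 := intervalIntegral.integral_mul_deriv_eq_deriv_mul (a := a) (b := b)
    (fun x _ => hu' x) (fun x _ => hf x)
    (continuous_const.intervalIntegrable _ _) (cf'.intervalIntegrable _ _)
  have h3 : (b - a) * ((f a + f b) / 2) - ∫ x in a..b, f x
      = ∫ x in a..b, (x - a) * (b - x) / 2 * f'' x := by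
    rw [h1, h2]
    simp only [neg_mul, one_mul, intervalIntegral.integral_neg]
    ring
  rw [h3, ← intervalIntegral.integral_const_mul]
  refine (intervalIntegral.abs_integral_le_integral_abs hab).trans ?_
  refine intervalIntegral.integral_mono_on hab ?_ ?_ ?_
  · exact Continuous.intervalIntegrable (by fun_prop) _ _
  · exact Continuous.intervalIntegrable (by fun_prop) _ _
  · intro x hx
    have h0 : 0 ≤ (x - a) * (b - x) / 2 :=
      div_nonneg (mul_nonneg (sub_nonneg.2 hx.1) (sub_nonneg.2 hx.2)) (by norm_num)
    rw [abs_mul, abs_of_nonneg h0]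
    refine mul_le_mul_of_nonneg_right ?_ (abs_nonneg _)
    nlinarith [sq_nonneg ((x - a) - (b - x))]

/-- The composite trapezoidal rule on `[a, a + K h]` has error at most `h² / 8` times the
`L¹` norm of the second derivative. -/
theorem abs_trapezoid_sub_integral_le {f f' f'' : ℝ → ℝ} (hf : ∀ x, HasDerivAt f (f' x) x)
    (hf' : ∀ x, HasDerivAt f' (f'' x) x) (hc : Continuous f'') (a : ℝ) {h : ℝ} (hh : 0 ≤ h)
    (K : ℕ) :
    |h * (∑ j ∈ Finset.range K, f (a + (j + 1) * h) + (f a - f (a + K * h)) / 2)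
        - ∫ x in a..(a + K * h), f x| ≤ h ^ 2 / 8 * ∫ x in a..(a + K * h), |f'' x| := by
  have cf : Continuous f := continuous_iff_continuousAt.2 fun x => (hf x).continuousAt
  induction K with
  | zero => simp
  | succ K ih =>
    have hle : a + K * h ≤ a + (K + 1) * h := by nlinarith
    have hp := abs_trapezoid_panel_sub_integral_le hf hf' hc hle
    have e1 : a + ((K : ℝ) + 1) * h - (a + K * h) = h := by ring
    rw [e1] at hp
    have i1 := intervalIntegral.integral_add_adjacent_intervals
      (cf.intervalIntegrable (μ := volume) a (a + K * h))
      (cf.intervalIntegrable (μ := volume) (a + K * h) (a + (K + 1) * h))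
    have i2 := intervalIntegral.integral_add_adjacent_intervals
      (hc.abs.intervalIntegrable (μ := volume) a (a + K * h))
      (hc.abs.intervalIntegrable (μ := volume) (a + K * h) (a + (K + 1) * h))
    push_cast
    rw [← i1, ← i2, Finset.sum_range_succ, mul_add (h ^ 2 / 8)]
    refine le_trans (le_of_eq ?_) ((abs_add_le _ _).trans (add_le_add ih hp))
    congr 1
    ring

/-- The trapezoidal rule on a half-line. -/
theorem abs_trapezoid_tsum_sub_integral_le {f f' f'' : ℝ → ℝ}
    (hf : ∀ x, HasDerivAt f (f' x) x) (hf' : ∀ x, HasDerivAt f' (f'' x) x)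
    (hc : Continuous f'') (a : ℝ) {h : ℝ} (hh : 0 < h)
    (hi : IntegrableOn f (Set.Ioi a)) (hs : Summable fun j : ℕ => f (a + (j + 1) * h))
    {C : ℝ} (hC : ∀ b, a ≤ b → ∫ x in a..b, |f'' x| ≤ C) :
    |h * (∑' j : ℕ, f (a + (j + 1) * h) + f a / 2) - ∫ x in Set.Ioi a, f x| ≤ h ^ 2 / 8 * C := by
  have ht : Tendsto (fun K : ℕ => a + (K : ℝ) * h) atTop atTop :=
    tendsto_atTop_add_const_left _ _ (tendsto_natCast_atTop_atTop.atTop_mul_const hh)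
  have h0 : Tendsto (fun K : ℕ => f (a + (K : ℝ) * h)) atTop (nhds 0) := by
    refine (tendsto_add_atTop_iff_nat 1).1 ?_
    simpa using hs.tendsto_atTop_zero
  have h1 := ((((hs.hasSum.tendsto_sum_nat).add
    (((tendsto_const_nhds (x := f a)).sub h0).div_const 2)).const_mul h).sub
    (intervalIntegral_tendsto_integral_Ioi a hi ht)).abs
  rw [sub_zero] at h1
  refine le_of_tendsto h1 (Eventually.of_forall fun K => ?_)
  refine (abs_trapezoid_sub_integral_le hf hf' hc a hh.le K).trans ?_
  gcongr
  exact hC _ (by nlinarith [mul_nonneg (Nat.cast_nonneg (α := ℝ) K) hh.le])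

/-- Integrals of functions dominated by the Cauchy density are bounded uniformly. -/
theorem intervalIntegral_abs_le_of_le_inv_one_add_sq {g : ℝ → ℝ} (hg : Continuous g) {C : ℝ}
    (hC : 0 ≤ C) {a b : ℝ} (hab : a ≤ b) (hle : ∀ x ∈ Set.Icc a b, |g x| ≤ C / (1 + x ^ 2)) :
    ∫ x in a..b, |g x| ≤ C * Real.pi := by
  have hc : Continuous fun x : ℝ => C / (1 + x ^ 2) :=
    continuous_const.div (by fun_prop) fun x => by positivity
  refine (intervalIntegral.integral_mono_on hab (hg.abs.intervalIntegrable _ _)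
    (hc.intervalIntegrable _ _) hle).trans ?_
  simp only [div_eq_mul_inv, intervalIntegral.integral_const_mul, integral_inv_one_add_sq]
  refine mul_le_mul_of_nonneg_left ?_ hC
  have := Real.arctan_lt_pi_div_two b
  have := Real.neg_pi_div_two_lt_arctan a
  linarith

/-! ### The Gaussian lattice sum -/

/-- Exponential decay beats polynomial growth, in the form used throughout. -/
theorem exists_one_add_pow_mul_exp_neg_le (d m : ℕ) {c : ℝ} (hc : 0 < c) :
    ∃ C : ℝ, 0 < C ∧ ∀ t : ℝ, 0 ≤ t → (1 + t) ^ d * Real.exp (-(c * t)) ≤ C / (1 + t) ^ m := by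
  refine ⟨Real.exp c * ((d + m).factorial / c ^ (d + m)), by positivity, fun t ht => ?_⟩
  have h1 := Real.pow_div_factorial_le_exp (c * (1 + t)) (by positivity) (d + m)
  have hf : (0 : ℝ) < (d + m).factorial := by positivity
  rw [div_le_iff₀ hf, mul_pow] at h1
  rw [le_div_iff₀ (by positivity), mul_right_comm, ← pow_add]
  have h2 : Real.exp (c * (1 + t)) = Real.exp c * Real.exp (c * t) := by
    rw [← Real.exp_add]; ring_nf
  rw [h2] at h1
  rw [Real.exp_neg, ← div_eq_mul_inv, div_le_iff₀ (Real.exp_pos _), mul_div_assoc',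
    div_mul_eq_mul_div,
    le_div_iff₀ (by positivity)]
  linarith

/-- The function `x ↦ x^k exp (-c x²)` at the inverse of its argument; it is flat at `0`. -/
noncomputable def invGauss (c : ℝ) (k : ℕ) (y : ℝ) : ℝ := y⁻¹ ^ k * Real.exp (-(c * y⁻¹ ^ 2))

theorem hasDerivAt_invGauss {c : ℝ} (hc : 0 < c) (k : ℕ) (y : ℝ) :
    HasDerivAt (invGauss c (k + 1))
      (-(k + 1) * invGauss c (k + 2) y + 2 * c * invGauss c (k + 4) y) y := by
  rcases eq_or_ne y 0 with rfl | hy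
  · obtain ⟨C, hC, hb⟩ := exists_one_add_pow_mul_exp_neg_le (k + 3) 0 hc
    simp only [invGauss, inv_zero, ne_eq, Nat.add_eq_zero_iff, OfNat.ofNat_ne_zero, and_false,
      not_false_eq_true, zero_pow, zero_mul, mul_zero, add_zero]
    rw [hasDerivAt_iff_isLittleO_nhds_zero]
    refine (IsBigO.of_bound C (g := fun y : ℝ => y ^ 2)
      (Eventually.of_forall fun y => ?_)).trans_isLittleO
      (by simpa using isLittleO_pow_id (𝕜 := ℝ) one_lt_two)
    have h0 : (invGauss c (k + 1) 0) = 0 := by simp [invGauss]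
    simp only [zero_add, h0, sub_zero, smul_zero, Real.norm_eq_abs]
    rcases eq_or_ne y 0 with rfl | hy
    · simp [h0]
    · have := hb (y⁻¹ ^ 2) (by positivity)
      rw [pow_zero, div_one] at this
      have h3 : |y⁻¹| ^ (k + 3) ≤ (1 + y⁻¹ ^ 2) ^ (k + 3) := by
        refine pow_le_pow_left₀ (abs_nonneg _) ?_ _
        nlinarith [sq_abs y⁻¹, sq_nonneg (|y⁻¹| - 1), abs_nonneg y⁻¹]
      have h4 : |y⁻¹ ^ (k + 1) * Real.exp (-(c * y⁻¹ ^ 2))|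
          = |y⁻¹| ^ (k + 3) * Real.exp (-(c * y⁻¹ ^ 2)) * y ^ 2 := by
        rw [abs_mul, abs_pow, abs_of_pos (Real.exp_pos _), pow_add _ k 3, pow_add _ k 1, ← sq_abs y,
          abs_inv]
        have : |y| ≠ 0 := abs_ne_zero.2 hy
        field_simp
      rw [invGauss, h4, abs_of_nonneg (sq_nonneg y)]
      refine mul_le_mul_of_nonneg_right (le_trans ?_ this) (sq_nonneg _)
      exact mul_le_mul_of_nonneg_right h3 (Real.exp_pos _).le
  · have h1 := hasDerivAt_inv hy
    have h2 := (h1.pow (k + 1)).mul (((h1.pow 2).const_mul c).neg.exp)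
    refine h2.congr_deriv ?_
    simp only [invGauss, Pi.pow_apply, Pi.neg_apply, Nat.cast_add, Nat.cast_one,
      Nat.add_sub_cancel, ← inv_pow]
    push_cast
    ring

theorem continuous_invGauss {c : ℝ} (hc : 0 < c) (k : ℕ) : Continuous (invGauss c (k + 1)) :=
  continuous_iff_continuousAt.2 fun y => (hasDerivAt_invGauss hc k y).continuousAt

/-- `(j+1)² y⁻³ exp (-(j+1)²/y²)`, the `j`-th term of the lattice sum. -/
noncomputable def latticeTerm (j : ℕ) (y : ℝ) : ℝ :=
  ((j : ℝ) + 1) ^ 2 * invGauss (((j : ℝ) + 1) ^ 2) 3 y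

/-- One minus the Riemann sum with step `1 / y` of the probability density
`4 / √π * x² exp (-x²)` on the half-line. -/
noncomputable def latticeDefect (y : ℝ) : ℝ := 1 - 4 / √Real.pi * ∑' j : ℕ, latticeTerm j y

/-- The function whose rescaled lattice sum is the second derivative of that of `x² exp (-x²)`
with respect to the scale. -/
noncomputable def scaleSecond (x : ℝ) : ℝ :=
  (12 * x ^ 2 - 18 * x ^ 4 + 4 * x ^ 6) * Real.exp (-x ^ 2)

theorem hasDerivAt_poly_mul_gauss {p p' : ℝ → ℝ} {x : ℝ} (hp : HasDerivAt p (p' x) x) :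
    HasDerivAt (fun x => p x * Real.exp (-x ^ 2)) ((p' x - 2 * x * p x) * Real.exp (-x ^ 2)) x := by
  refine (hp.mul (((hasDerivAt_pow 2 x).neg).exp)).congr_deriv ?_
  simp only [Pi.neg_apply]
  push_cast
  ring

theorem hasDerivAt_latticeTerm (j : ℕ) (y : ℝ) :
    HasDerivAt (latticeTerm j) (((j : ℝ) + 1) ^ 2 * (-3 * invGauss (((j : ℝ) + 1) ^ 2) 4 y
      + 2 * ((j : ℝ) + 1) ^ 2 * invGauss (((j : ℝ) + 1) ^ 2) 6 y)) y := by
  refine ((hasDerivAt_invGauss (c := ((j : ℝ) + 1) ^ 2) (by positivity) 2 y).const_mul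
    _).congr_deriv ?_
  norm_num

/-- The second derivative of a lattice term is a lattice term of another profile. -/
theorem hasDerivAt_deriv_latticeTerm (j : ℕ) (y : ℝ) :
    HasDerivAt (fun y => ((j : ℝ) + 1) ^ 2 * (-3 * invGauss (((j : ℝ) + 1) ^ 2) 4 y
      + 2 * ((j : ℝ) + 1) ^ 2 * invGauss (((j : ℝ) + 1) ^ 2) 6 y))
      (y⁻¹ ^ 3 * scaleSecond ((j + 1) * y⁻¹)) y := by
  have h4 := hasDerivAt_invGauss (c := ((j : ℝ) + 1) ^ 2) (by positivity) 3 y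
  have h6 := hasDerivAt_invGauss (c := ((j : ℝ) + 1) ^ 2) (by positivity) 5 y
  refine (((h4.const_mul (-3)).add (h6.const_mul (2 * ((j : ℝ) + 1) ^ 2))).const_mul
    (((j : ℝ) + 1) ^ 2)).congr_deriv ?_
  have : -(((j : ℝ) + 1) * y⁻¹) ^ 2 = -(((j : ℝ) + 1) ^ 2 * y⁻¹ ^ 2) := by ring
  simp only [invGauss, scaleSecond, this]
  push_cast
  ring

theorem continuous_second_deriv_latticeTerm (j : ℕ) :
    Continuous fun y : ℝ => y⁻¹ ^ 3 * scaleSecond ((j + 1) * y⁻¹) := by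
  have h : ∀ k, Continuous (invGauss (((j : ℝ) + 1) ^ 2) (k + 1)) := fun k =>
    continuous_invGauss (by positivity) k
  have e : (fun y : ℝ => y⁻¹ ^ 3 * scaleSecond ((j + 1) * y⁻¹)) = fun y =>
      12 * ((j : ℝ) + 1) ^ 2 * invGauss (((j : ℝ) + 1) ^ 2) (4 + 1) y
      - 18 * ((j : ℝ) + 1) ^ 4 * invGauss (((j : ℝ) + 1) ^ 2) (6 + 1) y
      + 4 * ((j : ℝ) + 1) ^ 6 * invGauss (((j : ℝ) + 1) ^ 2) (8 + 1) y := by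
    funext y
    have : -(((j : ℝ) + 1) * y⁻¹) ^ 2 = -(((j : ℝ) + 1) ^ 2 * y⁻¹ ^ 2) := by ring
    simp only [invGauss, scaleSecond, this]
    ring
  rw [e]
  exact ((continuous_const.mul (h 4)).sub (continuous_const.mul (h 6))).add
    (continuous_const.mul (h 8))

theorem integral_latticeTerm (j : ℕ) {Y : ℝ} (hY : 0 < Y) :
    ∫ y in (0 : ℝ)..Y, latticeTerm j y = Real.exp (-(((j : ℝ) + 1) * Y⁻¹) ^ 2) / 2 := by
  have hc : (0 : ℝ) < ((j : ℝ) + 1) ^ 2 := by positivity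
  have hd : ∀ y : ℝ, HasDerivAt (fun y => y * invGauss (((j : ℝ) + 1) ^ 2) 1 y / 2)
      (latticeTerm j y) y := by
    intro y
    refine (((hasDerivAt_id' y).mul (hasDerivAt_invGauss hc 0 y)).div_const 2).congr_deriv ?_
    rcases eq_or_ne y 0 with rfl | hy
    · simp [latticeTerm, invGauss]
    · obtain ⟨z, rfl⟩ : ∃ z, y = z⁻¹ := ⟨y⁻¹, by simp⟩
      have hz : z ≠ 0 := by rintro rfl; simp at hy
      simp only [latticeTerm, invGauss, inv_inv]
      field_simp
      push_cast
      ring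
  have hcont : Continuous (latticeTerm j) := continuous_const.mul (continuous_invGauss hc 2)
  rw [intervalIntegral.integral_eq_sub_of_hasDerivAt (fun y _ => hd y)
    (hcont.intervalIntegrable _ _)]
  have : -(((j : ℝ) + 1) * Y⁻¹) ^ 2 = -(((j : ℝ) + 1) ^ 2 * Y⁻¹ ^ 2) := by ring
  simp only [invGauss, this]
  field_simp
  simp

theorem exists_poly_gauss_le {p : ℝ → ℝ} {K : ℝ} (d m : ℕ)
    (hp : ∀ x, |p x| ≤ K * (1 + x ^ 2) ^ d) :
    ∃ C : ℝ, 0 < C ∧ ∀ x, |p x * Real.exp (-x ^ 2)| ≤ C / (1 + x ^ 2) ^ m := by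
  obtain ⟨C, hC, hb⟩ := exists_one_add_pow_mul_exp_neg_le d m one_pos
  refine ⟨(|K| + 1) * C, by positivity, fun x => ?_⟩
  have h1 := hb (x ^ 2) (sq_nonneg x)
  rw [one_mul] at h1
  rw [abs_mul, abs_of_pos (Real.exp_pos _)]
  calc |p x| * Real.exp (-x ^ 2) ≤ ((|K| + 1) * (1 + x ^ 2) ^ d) * Real.exp (-x ^ 2) := by
        refine mul_le_mul_of_nonneg_right ((hp x).trans ?_) (Real.exp_pos _).le
        refine mul_le_mul_of_nonneg_right ?_ (by positivity)
        linarith [le_abs_self K]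
    _ = (|K| + 1) * ((1 + x ^ 2) ^ d * Real.exp (-x ^ 2)) := by ring
    _ ≤ (|K| + 1) * (C / (1 + x ^ 2) ^ m) := by gcongr
    _ = _ := by ring

theorem abs_pow_le_one_add_sq_pow (x : ℝ) {k d : ℕ} (h : k ≤ d) : |x| ^ k ≤ (1 + x ^ 2) ^ d := by
  have h1 : |x| ≤ 1 + x ^ 2 := by
    nlinarith [sq_abs x, sq_nonneg (|x| - 1), abs_nonneg x]
  calc |x| ^ k ≤ (1 + x ^ 2) ^ k := pow_le_pow_left₀ (abs_nonneg _) h1 _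
    _ ≤ (1 + x ^ 2) ^ d := pow_le_pow_right₀ (by nlinarith [sq_nonneg x]) h

theorem summable_gauss_lattice {f : ℝ → ℝ} {C : ℝ} (hf : ∀ x, |f x| ≤ C / (1 + x ^ 2)) (a : ℝ)
    (ha : 0 ≤ a) {h : ℝ} (hh : 0 < h) : Summable fun j : ℕ => f (a + (j + 1) * h) := by
  have hC : 0 ≤ C := by simpa using (abs_nonneg _).trans (hf 0)
  have hs : Summable fun j : ℕ => C / h ^ 2 * (1 / ((j : ℝ) + 1) ^ 2) := by
    refine Summable.mul_left _ ?_
    have := (summable_nat_add_iff 1).2 (Real.summable_one_div_nat_pow.2 one_lt_two)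
    simpa using this
  refine Summable.of_norm_bounded hs fun j => (hf _).trans ?_
  rw [div_mul_div_comm, mul_one, ← mul_pow]
  have : (h * ((j : ℝ) + 1)) ^ 2 ≤ (a + (j + 1) * h) ^ 2 :=
    pow_le_pow_left₀ (by positivity) (by linarith) 2
  exact div_le_div_of_nonneg_left hC (by positivity) (by linarith)

/-- The profile `x² exp (-x²)`. -/
noncomputable def bump (x : ℝ) : ℝ := x ^ 2 * Real.exp (-x ^ 2)

/-- The derivative of `bump`. -/
noncomputable def bump' (x : ℝ) : ℝ := (2 * x - 2 * x ^ 3) * Real.exp (-x ^ 2)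

/-- The second derivative of `bump`. -/
noncomputable def bump'' (x : ℝ) : ℝ := (2 - 10 * x ^ 2 + 4 * x ^ 4) * Real.exp (-x ^ 2)

theorem hasDerivAt_bump (x : ℝ) : HasDerivAt bump (bump' x) x := by
  refine (hasDerivAt_poly_mul_gauss (p := fun x => x ^ 2) (p' := fun x => 2 * x) ?_).congr_deriv ?_
  · simpa using hasDerivAt_pow 2 x
  · simp only [bump']; ring

theorem hasDerivAt_bump' (x : ℝ) : HasDerivAt bump' (bump'' x) x := by
  refine (hasDerivAt_poly_mul_gauss (p := fun x => 2 * x - 2 * x ^ 3)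
    (p' := fun x => 2 - 6 * x ^ 2) ?_).congr_deriv ?_
  · refine (((hasDerivAt_id' x).const_mul 2).sub ((hasDerivAt_pow 3 x).const_mul 2)).congr_deriv ?_
    push_cast; ring
  · simp only [bump'']; ring

theorem continuous_bump'' : Continuous bump'' := by unfold bump''; fun_prop

theorem continuous_bump : Continuous bump := by unfold bump; fun_prop

theorem exists_bump_le (m : ℕ) : ∃ C : ℝ, 0 < C ∧ ∀ x, |bump x| ≤ C / (1 + x ^ 2) ^ m :=
  exists_poly_gauss_le (K := 1) 2 m fun x => by
    rw [abs_pow, one_mul]; exact abs_pow_le_one_add_sq_pow x le_rfl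

theorem exists_bump''_le (m : ℕ) : ∃ C : ℝ, 0 < C ∧ ∀ x, |bump'' x| ≤ C / (1 + x ^ 2) ^ m :=
  exists_poly_gauss_le (K := 16) 2 m fun x => by
    rw [abs_le]; constructor <;> nlinarith [sq_nonneg (x ^ 2), sq_nonneg x]

theorem integrable_of_le_inv_one_add_sq {f : ℝ → ℝ} (hf : Continuous f) {C : ℝ}
    (h : ∀ x, |f x| ≤ C / (1 + x ^ 2)) : Integrable f := by
  refine (integrable_inv_one_add_sq.const_mul C).mono' hf.aestronglyMeasurable
    (Eventually.of_forall fun x => ?_)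
  simpa [div_eq_mul_inv] using h x

theorem integrable_bump : Integrable bump := by
  obtain ⟨C, -, hC⟩ := exists_bump_le 1
  exact integrable_of_le_inv_one_add_sq continuous_bump (by simpa using hC)

theorem integral_Ioi_bump : ∫ x in Set.Ioi (0 : ℝ), bump x = √Real.pi / 4 := by
  have h := integral_rpow_mul_exp_neg_rpow (p := 2) (q := 2) (by norm_num) (by norm_num)
  have e : (2 + 1 : ℝ) / 2 = 1 / 2 + 1 := by norm_num
  rw [e, Real.Gamma_add_one (by norm_num), Real.Gamma_one_half_eq] at h
  have h2 : ∫ x in Set.Ioi (0 : ℝ), bump x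
      = ∫ x in Set.Ioi (0 : ℝ), x ^ (2 : ℝ) * Real.exp (-x ^ (2 : ℝ)) := by
    simp [bump]
  rw [h2, h]; ring

/-- Trapezoidal sums of the profile on `[a, ∞)`; the bound decays in `a`. -/
theorem exists_trapezoid_bump : ∃ C : ℝ, 0 < C ∧ ∀ a h : ℝ, 0 ≤ a → 0 < h →
    |h * (∑' j : ℕ, bump (a + (j + 1) * h) + bump a / 2) - ∫ x in Set.Ioi a, bump x|
      ≤ C * h ^ 2 / (1 + a ^ 2) ^ 2 := by
  obtain ⟨C₁, hC₁, h₁⟩ := exists_bump_le 1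
  obtain ⟨C, hC, h₂⟩ := exists_bump''_le 3
  refine ⟨C * Real.pi / 8, by positivity, fun a h ha hh => ?_⟩
  refine (abs_trapezoid_tsum_sub_integral_le hasDerivAt_bump hasDerivAt_bump' continuous_bump'' a hh
    integrable_bump.integrableOn (summable_gauss_lattice (by simpa using h₁) a ha hh)
    (C := C / (1 + a ^ 2) ^ 2 * Real.pi) fun b hab => ?_).trans (le_of_eq (by ring))
  refine intervalIntegral_abs_le_of_le_inv_one_add_sq continuous_bump'' (by positivity) hab
    fun x hx => (h₂ x).trans ?_
  rw [div_div]
  refine div_le_div_of_nonneg_left hC.le (by positivity) ?_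
  have : a ^ 2 ≤ x ^ 2 := pow_le_pow_left₀ ha hx.1 2
  calc (1 + a ^ 2) ^ 2 * (1 + x ^ 2) ≤ (1 + x ^ 2) ^ 2 * (1 + x ^ 2) := by gcongr
    _ = (1 + x ^ 2) ^ 3 := by ring

theorem latticeTerm_eq (j : ℕ) (y : ℝ) : latticeTerm j y = y⁻¹ * bump ((j + 1) * y⁻¹) := by
  have : -(((j : ℝ) + 1) * y⁻¹) ^ 2 = -(((j : ℝ) + 1) ^ 2 * y⁻¹ ^ 2) := by ring
  simp only [latticeTerm, invGauss, bump, this]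
  ring

theorem summable_latticeTerm {y : ℝ} (hy : 0 < y) : Summable fun j => latticeTerm j y := by
  obtain ⟨C₁, hC₁, h₁⟩ := exists_bump_le 1
  have := summable_gauss_lattice (by simpa using h₁) 0 le_rfl (inv_pos.2 hy)
  simpa [latticeTerm_eq] using this.mul_left y⁻¹

/-- The trapezoidal rule with step `1 / y` has error `O(1 / y²)`. -/
theorem exists_latticeDefect_le : ∃ C : ℝ, 0 < C ∧ ∀ y : ℝ, 0 < y →
    |latticeDefect y| ≤ C / y ^ 2 := by
  obtain ⟨C, hC, h⟩ := exists_trapezoid_bump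
  have hpi : 0 < √Real.pi := Real.sqrt_pos.2 Real.pi_pos
  refine ⟨4 / √Real.pi * C, by positivity, fun y hy => ?_⟩
  have h1 := h 0 y⁻¹ le_rfl (inv_pos.2 hy)
  have e : latticeDefect y = -(4 / √Real.pi) *
      (y⁻¹ * (∑' j : ℕ, bump (0 + (j + 1) * y⁻¹) + bump 0 / 2) - √Real.pi / 4) := by
    simp only [latticeDefect, latticeTerm_eq, tsum_mul_left]
    simp [bump]
    field_simp
    ring
  rw [integral_Ioi_bump] at h1
  rw [e, abs_mul, abs_neg, abs_of_pos (by positivity : 0 < 4 / √Real.pi), mul_div_assoc]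
  refine mul_le_mul_of_nonneg_left (h1.trans (le_of_eq ?_)) (by positivity)
  simp [div_eq_mul_inv]

/-- The integral of `latticeDefect` over `[0, Y]`, evaluated term by term, tends to `1 / √π`: up
to a factor it is the error of a Riemann sum of `exp (-x²)` with step `1 / Y`, multiplied by `Y`,
and what this sum lacks to the trapezoidal rule is half of the term at `0`. -/
theorem exists_integral_latticeDefect_sub_le : ∃ C : ℝ, 0 < C ∧ ∀ Y : ℝ, 0 < Y →
    Summable (fun j : ℕ => Real.exp (-(((j : ℝ) + 1) * Y⁻¹) ^ 2)) ∧
    |Y - 4 / √Real.pi * ∑' j : ℕ, Real.exp (-(((j : ℝ) + 1) * Y⁻¹) ^ 2) / 2 - 1 / √Real.pi|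
      ≤ C / Y := by
  have hpi : 0 < √Real.pi := Real.sqrt_pos.2 Real.pi_pos
  obtain ⟨C₁, hC₁, h₁⟩ := exists_poly_gauss_le (p := fun _ => 1) (K := 1) 0 1 (by simp)
  obtain ⟨C, hC, h₂⟩ := exists_poly_gauss_le (p := fun x => -2 + 4 * x ^ 2) (K := 4) 1 1
    (fun x => by rw [abs_le]; constructor <;> nlinarith [sq_nonneg x])
  simp only [one_mul, pow_one] at h₁ h₂
  have d1 : ∀ x : ℝ, HasDerivAt (fun x => Real.exp (-x ^ 2)) (-2 * x * Real.exp (-x ^ 2)) x := by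
    intro x
    have := hasDerivAt_poly_mul_gauss (p := fun _ => 1) (p' := fun _ => 0) (hasDerivAt_const x 1)
    simpa using this
  have d2 : ∀ x : ℝ, HasDerivAt (fun x => -2 * x * Real.exp (-x ^ 2))
      ((-2 + 4 * x ^ 2) * Real.exp (-x ^ 2)) x := by
    intro x
    refine (hasDerivAt_poly_mul_gauss (p := fun x => -2 * x) (p' := fun _ => -2)
      (by simpa using (hasDerivAt_id' x).const_mul (-2 : ℝ))).congr_deriv ?_
    ring
  refine ⟨2 / √Real.pi * (1 / 8 * (C * Real.pi)), by positivity, fun Y hY => ?_⟩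
  have hs := summable_gauss_lattice h₁ 0 le_rfl (inv_pos.2 hY)
  have h3 := abs_trapezoid_tsum_sub_integral_le d1 d2 (by fun_prop) 0 (inv_pos.2 hY)
    (integrable_of_le_inv_one_add_sq (by fun_prop) h₁).integrableOn hs (C := C * Real.pi)
    fun b hab => intervalIntegral_abs_le_of_le_inv_one_add_sq (by fun_prop) hC.le hab
      fun x _ => h₂ x
  have hint : ∫ x in Set.Ioi (0 : ℝ), Real.exp (-x ^ 2) = √Real.pi / 2 := by
    simpa using integral_gaussian_Ioi 1
  simp only [zero_add] at hs h3
  refine ⟨hs, ?_⟩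
  rw [hint] at h3
  rw [tsum_div_const]
  set S := ∑' j : ℕ, Real.exp (-(((j : ℝ) + 1) * Y⁻¹) ^ 2)
  have e : Y - 4 / √Real.pi * (S / 2) - 1 / √Real.pi = -(2 / √Real.pi * Y) *
      (Y⁻¹ * (S + Real.exp (-0 ^ 2) / 2) - √Real.pi / 2) := by
    simp
    field_simp
    ring
  rw [e, abs_mul, abs_neg, abs_of_pos (by positivity : 0 < 2 / √Real.pi * Y)]
  calc _ ≤ 2 / √Real.pi * Y * (Y⁻¹ ^ 2 / 8 * (C * Real.pi)) := by gcongr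
    _ = _ := by field_simp

theorem exists_scaleSecond_le (m : ℕ) :
    ∃ C : ℝ, 0 < C ∧ ∀ x, |scaleSecond x| ≤ C / (1 + x ^ 2) ^ m :=
  exists_poly_gauss_le (K := 34) 3 m fun x => by
    have h2 := sq_nonneg x
    have h4 := mul_nonneg h2 h2
    have h6 := mul_nonneg h4 h2
    rw [abs_le]; constructor <;> nlinarith

theorem sum_one_div_succ_sq_le (K : ℕ) : ∑ j ∈ Finset.range K, 1 / ((j : ℝ) + 1) ^ 2 ≤ 2 := by
  suffices h : ∑ j ∈ Finset.range K, 1 / ((j : ℝ) + 1) ^ 2 ≤ 2 - 1 / (K : ℝ) by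
    have : (0 : ℝ) ≤ 1 / (K : ℝ) := by positivity
    linarith
  induction K with
  | zero => simp
  | succ K ih =>
    rw [Finset.sum_range_succ]
    rcases Nat.eq_zero_or_pos K with rfl | hK
    · simp; norm_num
    · have hK' : (0 : ℝ) < K := by exact_mod_cast hK
      have h5 : 1 / ((K : ℝ) + 1) ^ 2 ≤ 1 / K - 1 / (K + 1) := by
        rw [div_sub_div _ _ (by positivity) (by positivity),
          div_le_div_iff₀ (by positivity) (by positivity)]
        nlinarith
      push_cast
      linarith

/-- The lattice sums of `scaleSecond` are small at both ends: for small `y` because the function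
decays, for large `y` because it vanishes at `0` and has integral `0` over the half-line, so that
only the error of the trapezoidal rule is left. The term `1 / J ^ 2` accounts for the truncation. -/
theorem exists_sum_scaleSecond_le : ∃ C : ℝ, 0 < C ∧ ∀ y : ℝ, 0 ≤ y → ∀ J : ℕ, 1 ≤ J →
    |∑ j ∈ Finset.range J, y⁻¹ ^ 3 * scaleSecond ((j + 1) * y⁻¹)|
      ≤ C * (1 / (1 + y ^ 2) + 1 / (J : ℝ) ^ 2) := by
  have d1 : ∀ x : ℝ, HasDerivAt (fun x => (4 * x ^ 3 - 2 * x ^ 5) * Real.exp (-x ^ 2))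
      (scaleSecond x) x := by
    intro x
    refine (hasDerivAt_poly_mul_gauss (p := fun x => 4 * x ^ 3 - 2 * x ^ 5)
      (p' := fun x => 12 * x ^ 2 - 10 * x ^ 4) ?_).congr_deriv ?_
    · refine (((hasDerivAt_pow 3 x).const_mul 4).sub
        ((hasDerivAt_pow 5 x).const_mul 2)).congr_deriv ?_
      push_cast; ring
    · simp only [scaleSecond]; ring
  have d2 : ∀ x : ℝ, HasDerivAt scaleSecond
      ((24 * x - 96 * x ^ 3 + 60 * x ^ 5 - 8 * x ^ 7) * Real.exp (-x ^ 2)) x := by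
    intro x
    refine (hasDerivAt_poly_mul_gauss (p := fun x => 12 * x ^ 2 - 18 * x ^ 4 + 4 * x ^ 6)
      (p' := fun x => 24 * x - 72 * x ^ 3 + 24 * x ^ 5) ?_).congr_deriv ?_
    · refine ((((hasDerivAt_pow 2 x).const_mul 12).sub
        ((hasDerivAt_pow 4 x).const_mul 18)).add ((hasDerivAt_pow 6 x).const_mul 4)).congr_deriv ?_
      push_cast; ring
    · ring
  have d3 : ∀ x : ℝ, HasDerivAt
      (fun x => (24 * x - 96 * x ^ 3 + 60 * x ^ 5 - 8 * x ^ 7) * Real.exp (-x ^ 2))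
      ((24 - 336 * x ^ 2 + 492 * x ^ 4 - 176 * x ^ 6 + 16 * x ^ 8) * Real.exp (-x ^ 2)) x := by
    intro x
    refine (hasDerivAt_poly_mul_gauss (p := fun x => 24 * x - 96 * x ^ 3 + 60 * x ^ 5 - 8 * x ^ 7)
      (p' := fun x => 24 - 288 * x ^ 2 + 300 * x ^ 4 - 56 * x ^ 6) ?_).congr_deriv ?_
    · refine (((((hasDerivAt_id' x).const_mul 24).sub
        ((hasDerivAt_pow 3 x).const_mul 96)).add ((hasDerivAt_pow 5 x).const_mul 60)).sub
        ((hasDerivAt_pow 7 x).const_mul 8)).congr_deriv ?_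
      push_cast; ring
    · ring
  have c1 : Continuous scaleSecond := by unfold scaleSecond; fun_prop
  obtain ⟨A, hA, bA⟩ := exists_poly_gauss_le (p := fun x => 4 * x ^ 3 - 2 * x ^ 5) (K := 6) 5 1
    (fun x => by
      have h3 := abs_pow_le_one_add_sq_pow x (show 3 ≤ 5 by norm_num)
      have h5 := abs_pow_le_one_add_sq_pow x (show 5 ≤ 5 by norm_num)
      rw [← abs_pow, abs_le] at h3 h5
      rw [abs_le]; constructor <;> linarith)
  obtain ⟨B, hB, bB⟩ := exists_poly_gauss_le
    (p := fun x => 24 - 336 * x ^ 2 + 492 * x ^ 4 - 176 * x ^ 6 + 16 * x ^ 8) (K := 1044) 8 1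
    (fun x => by
      have h0 := abs_pow_le_one_add_sq_pow x (show 0 ≤ 8 by norm_num)
      have h2 := abs_pow_le_one_add_sq_pow x (show 2 ≤ 8 by norm_num)
      have h4 := abs_pow_le_one_add_sq_pow x (show 4 ≤ 8 by norm_num)
      have h6 := abs_pow_le_one_add_sq_pow x (show 6 ≤ 8 by norm_num)
      have h8 := abs_pow_le_one_add_sq_pow x (show 8 ≤ 8 by norm_num)
      rw [pow_zero] at h0
      rw [← abs_pow, abs_le] at h2 h4 h6 h8
      rw [abs_le]; constructor <;> linarith)
  obtain ⟨D, hD, bD⟩ := exists_scaleSecond_le 2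
  obtain ⟨E, hE, bE⟩ := exists_scaleSecond_le 1
  simp only [pow_one] at bA bB bE
  refine ⟨4 * D + 2 * (B * Real.pi) + A + E, by positivity, fun y hy J hJ => ?_⟩
  have hJ0 : (0 : ℝ) < J := by exact_mod_cast hJ
  rcases hy.eq_or_lt with rfl | hy
  · simp; positivity
  rcases le_total y 1 with hy1 | hy1
  · -- small `y`: each term is at most `D y / (j + 1)²`
    have hterm : ∀ j ∈ Finset.range J, |y⁻¹ ^ 3 * scaleSecond ((j + 1) * y⁻¹)|
        ≤ D * (1 / ((j : ℝ) + 1) ^ 2) := by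
      intro j _
      rw [abs_mul, abs_of_pos (by positivity)]
      have h1 := bD (((j : ℝ) + 1) * y⁻¹)
      have h2 : D / (1 + (((j : ℝ) + 1) * y⁻¹) ^ 2) ^ 2 ≤ D / ((((j : ℝ) + 1) * y⁻¹) ^ 2) ^ 2 := by
        gcongr; linarith
      calc y⁻¹ ^ 3 * |scaleSecond ((j + 1) * y⁻¹)|
          ≤ y⁻¹ ^ 3 * (D / ((((j : ℝ) + 1) * y⁻¹) ^ 2) ^ 2) := by gcongr; exact h1.trans h2
        _ = D * (y * (1 / ((j : ℝ) + 1) ^ 4)) := by field_simp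
        _ ≤ D * (1 * (1 / ((j : ℝ) + 1) ^ 2)) := by
          gcongr
          · linarith
          · norm_num
        _ = _ := by rw [one_mul]
    have hsum := sum_one_div_succ_sq_le J
    have h4 : (1 : ℝ) / 2 ≤ 1 / (1 + y ^ 2) :=
      one_div_le_one_div_of_le (by positivity) (by nlinarith)
    calc _ ≤ ∑ j ∈ Finset.range J, |y⁻¹ ^ 3 * scaleSecond ((j + 1) * y⁻¹)| :=
          Finset.abs_sum_le_sum_abs _ _
      _ ≤ ∑ j ∈ Finset.range J, D * (1 / ((j : ℝ) + 1) ^ 2) := Finset.sum_le_sum hterm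
      _ ≤ D * 2 := by rw [← Finset.mul_sum]; gcongr
      _ = 4 * D * (1 / 2) := by ring
      _ ≤ (4 * D + 2 * (B * Real.pi) + A + E) * (1 / (1 + y ^ 2) + 1 / (J : ℝ) ^ 2) := by
        gcongr
        · have : 0 < B * Real.pi := by positivity
          linarith
        · have : 0 < 1 / (J : ℝ) ^ 2 := by positivity
          linarith
  · -- large `y`: the error of the trapezoidal rule for `scaleSecond` on `[0, J / y]`
    have h1 := abs_trapezoid_sub_integral_le d2 d3 (by fun_prop) 0 (inv_pos.2 hy).le J
    have hle : (0 : ℝ) ≤ 0 + J * y⁻¹ := by positivity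
    have h2 := intervalIntegral_abs_le_of_le_inv_one_add_sq (g := fun x =>
      (24 - 336 * x ^ 2 + 492 * x ^ 4 - 176 * x ^ 6 + 16 * x ^ 8) * Real.exp (-x ^ 2))
      (by fun_prop) hB.le hle fun x _ => bB x
    have h3 := intervalIntegral.integral_eq_sub_of_hasDerivAt (fun x _ => d1 x)
      (c1.intervalIntegrable (μ := volume) 0 (0 + J * y⁻¹))
    simp only [zero_add] at h1 h2 h3
    rw [h3] at h1
    have hz : scaleSecond 0 = 0 := by simp [scaleSecond]
    have hyi : 0 < y⁻¹ := inv_pos.2 hy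
    have hyi1 : y⁻¹ ≤ 1 := inv_le_one_of_one_le₀ hy1
    have gen : ∀ Z : ℝ, 0 < Z → Z / (1 + (J * y⁻¹) ^ 2) ≤ Z * (y ^ 2 / (J : ℝ) ^ 2) := by
      intro Z hZ
      have : Z * (y ^ 2 / (J : ℝ) ^ 2) = Z / (J * y⁻¹) ^ 2 := by field_simp
      rw [this]
      gcongr
      linarith
    have hA' := (bA (J * y⁻¹)).trans (gen A hA)
    have hE' := (bE (J * y⁻¹)).trans (gen E hE)
    set S := ∑ j ∈ Finset.range J, scaleSecond ((j + 1) * y⁻¹) with hS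
    set k := (4 * ((J : ℝ) * y⁻¹) ^ 3 - 2 * (J * y⁻¹) ^ 5) * Real.exp (-(J * y⁻¹) ^ 2) with hk
    rw [hz] at h1
    simp only [ne_eq, OfNat.ofNat_ne_zero, not_false_eq_true, zero_pow, mul_zero, sub_zero,
      zero_sub,
      zero_mul, neg_zero] at h1
    have hT : |y⁻¹ * S| ≤ B * Real.pi * y⁻¹ ^ 2 + (A + E) * (y ^ 2 / (J : ℝ) ^ 2) := by
      have e : y⁻¹ * S = (y⁻¹ * (S + -scaleSecond (J * y⁻¹) / 2) - k) + k
          + y⁻¹ * scaleSecond (J * y⁻¹) / 2 := by ring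
      have t3 : |y⁻¹ * scaleSecond (J * y⁻¹) / 2| ≤ E * (y ^ 2 / (J : ℝ) ^ 2) := by
        rw [abs_div, abs_mul, abs_of_pos hyi, abs_of_pos (by norm_num : (0 : ℝ) < 2)]
        have : y⁻¹ * |scaleSecond (J * y⁻¹)| ≤ 1 * |scaleSecond (J * y⁻¹)| := by gcongr
        have := abs_nonneg (scaleSecond (J * y⁻¹))
        linarith
      have t1 : y⁻¹ ^ 2 / 8 * ∫ x in (0 : ℝ)..J * y⁻¹,
          |(24 - 336 * x ^ 2 + 492 * x ^ 4 - 176 * x ^ 6 + 16 * x ^ 8) * Real.exp (-x ^ 2)|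
          ≤ B * Real.pi * y⁻¹ ^ 2 := by
        have : y⁻¹ ^ 2 / 8 * ∫ x in (0 : ℝ)..J * y⁻¹,
          |(24 - 336 * x ^ 2 + 492 * x ^ 4 - 176 * x ^ 6 + 16 * x ^ 8) * Real.exp (-x ^ 2)|
          ≤ y⁻¹ ^ 2 / 8 * (B * Real.pi) := by gcongr
        have : 0 < y⁻¹ ^ 2 * (B * Real.pi) := by positivity
        linarith
      rw [e]
      refine (abs_add_three _ _ _).trans ?_
      have := h1.trans t1
      linarith
    have e2 : ∑ j ∈ Finset.range J, y⁻¹ ^ 3 * scaleSecond ((j + 1) * y⁻¹)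
        = y⁻¹ ^ 2 * (y⁻¹ * S) := by rw [← Finset.mul_sum]; ring
    rw [e2, abs_mul, abs_of_pos (by positivity)]
    have h5 : y⁻¹ ^ 4 ≤ 2 * (1 / (1 + y ^ 2)) := by
      rw [inv_pow, ← one_div, mul_one_div, div_le_div_iff₀ (by positivity) (by positivity)]
      nlinarith [one_le_pow₀ hy1 (n := 2)]
    calc y⁻¹ ^ 2 * |y⁻¹ * S|
        ≤ y⁻¹ ^ 2 * (B * Real.pi * y⁻¹ ^ 2 + (A + E) * (y ^ 2 / (J : ℝ) ^ 2)) := by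
          gcongr
      _ = B * Real.pi * y⁻¹ ^ 4 + (A + E) * (1 / (J : ℝ) ^ 2) := by field_simp
      _ ≤ B * Real.pi * (2 * (1 / (1 + y ^ 2))) + (A + E) * (1 / (J : ℝ) ^ 2) := by gcongr
      _ ≤ _ := by
        have : 0 < 1 / (1 + y ^ 2) := by positivity
        have : 0 < 1 / (J : ℝ) ^ 2 := by positivity
        have h7 : 0 < B * Real.pi := by positivity
        have : 0 ≤ (4 * D + A + E) * (1 / (1 + y ^ 2)) := by positivity
        have : 0 ≤ (4 * D + 2 * (B * Real.pi)) * (1 / (J : ℝ) ^ 2) := by positivity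
        linarith

/-- The trapezoidal sum of `latticeDefect` with step `h` on `[0, M h]`, where the value at `0` is
`1`, agrees with the integral up to `O(h²)`. -/
theorem exists_trapezoid_latticeDefect : ∃ C : ℝ, 0 < C ∧ ∀ h : ℝ, 0 < h → ∀ M : ℕ, 1 ≤ M →
    |h * (∑ N ∈ Finset.range M, latticeDefect ((N + 1) * h)
        + (1 - latticeDefect (M * h)) / 2)
      - (M * h - 4 / √Real.pi * ∑' j : ℕ, Real.exp (-(((j : ℝ) + 1) * (M * h)⁻¹) ^ 2) / 2)|
      ≤ C * h ^ 2 := by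
  have hpi : 0 < √Real.pi := Real.sqrt_pos.2 Real.pi_pos
  obtain ⟨C, hC, hsum⟩ := exists_sum_scaleSecond_le
  obtain ⟨_, -, hexp⟩ := exists_integral_latticeDefect_sub_le
  refine ⟨4 / √Real.pi * C * Real.pi / 8, by positivity, fun h hh M hM => ?_⟩
  have hM0 : (0 : ℝ) < M := by exact_mod_cast hM
  have hY : 0 < M * h := by positivity
  set κ : ℝ := 4 / √Real.pi with hκ
  have hκ0 : 0 < κ := by positivity
  set P : ℕ → ℝ → ℝ := fun J y => 1 - κ * ∑ j ∈ Finset.range J, latticeTerm j y with hP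
  -- the trapezoidal rule for the partial sums
  have key : ∀ J : ℕ, 1 ≤ J →
      |h * (∑ N ∈ Finset.range M, P J ((N + 1) * h) + (1 - P J (M * h)) / 2)
      - (M * h - κ * ∑ j ∈ Finset.range J, Real.exp (-(((j : ℝ) + 1) * (M * h)⁻¹) ^ 2) / 2)|
      ≤ h ^ 2 / 8 * (κ * C * (Real.pi + M * h / (J : ℝ) ^ 2)) := by
    intro J hJ
    have d1 : ∀ y, HasDerivAt (P J) _ y := fun y =>
      ((HasDerivAt.fun_sum fun j (_ : j ∈ Finset.range J) =>
        hasDerivAt_latticeTerm j y).const_mul κ).const_sub 1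
    have d2 := fun y : ℝ => ((HasDerivAt.fun_sum fun j (_ : j ∈ Finset.range J) =>
      hasDerivAt_deriv_latticeTerm j y).const_mul κ).neg
    have c2 : Continuous fun y : ℝ =>
        -(κ * ∑ j ∈ Finset.range J, y⁻¹ ^ 3 * scaleSecond ((j + 1) * y⁻¹)) :=
      (continuous_const.mul (continuous_finsetSum _ fun j _ =>
        continuous_second_deriv_latticeTerm j)).neg
    have h1 := abs_trapezoid_sub_integral_le d1 d2 c2 0 hh.le M
    simp only [zero_add] at h1
    have e0 : P J 0 = 1 := by simp [hP, latticeTerm, invGauss]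
    have hcont : ∀ j, Continuous (latticeTerm j) := fun j =>
      continuous_iff_continuousAt.2 fun y => (hasDerivAt_latticeTerm j y).continuousAt
    have e1 : ∫ x in (0 : ℝ)..M * h, P J x
        = M * h - κ * ∑ j ∈ Finset.range J, Real.exp (-(((j : ℝ) + 1) * (M * h)⁻¹) ^ 2) / 2 := by
      simp only [hP]
      have i1 : IntervalIntegrable (fun y => κ * ∑ j ∈ Finset.range J, latticeTerm j y) volume
          0 (M * h) := Continuous.intervalIntegrable
        (continuous_const.mul (continuous_finsetSum _ fun j _ => hcont j)) _ _
      rw [intervalIntegral.integral_sub intervalIntegrable_const i1,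
        intervalIntegral.integral_const_mul, intervalIntegral.integral_finsetSum
          fun j _ => (hcont j).intervalIntegrable _ _]
      simp [integral_latticeTerm _ hY]
    rw [e0, e1] at h1
    refine h1.trans ?_
    gcongr
    have c3 : Continuous fun x : ℝ => κ * C * ((1 + x ^ 2)⁻¹ + 1 / (J : ℝ) ^ 2) := by
      refine continuous_const.mul (Continuous.add (Continuous.inv₀ (by fun_prop) fun x => ?_)
        continuous_const)
      positivity
    calc _ ≤ ∫ x in (0 : ℝ)..M * h, κ * C * ((1 + x ^ 2)⁻¹ + 1 / (J : ℝ) ^ 2) := by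
          refine intervalIntegral.integral_mono_on hY.le (c2.abs.intervalIntegrable _ _)
            (c3.intervalIntegrable _ _) fun x hx => ?_
          rw [abs_neg, abs_mul, abs_of_pos hκ0, mul_assoc]
          have := hsum x hx.1 J hJ
          rw [one_div (1 + x ^ 2)] at this
          gcongr
      _ ≤ _ := by
          have i2 : IntervalIntegrable (fun x : ℝ => (1 + x ^ 2)⁻¹) volume 0 (M * h) :=
            Continuous.intervalIntegrable
              (Continuous.inv₀ (by fun_prop) fun x => by positivity) _ _
          rw [intervalIntegral.integral_const_mul, intervalIntegral.integral_add i2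
            intervalIntegrable_const, integral_inv_one_add_sq]
          simp only [Real.arctan_zero, sub_zero, intervalIntegral.integral_const, smul_eq_mul]
          gcongr
          · have := Real.arctan_lt_pi_div_two (M * h)
            have := Real.pi_pos
            linarith
          · rw [mul_one_div]
  -- let the number of terms tend to infinity
  have tP : ∀ y : ℝ, 0 < y → Tendsto (fun J => P J y) atTop (nhds (latticeDefect y)) := fun y hy =>
    ((summable_latticeTerm hy).hasSum.tendsto_sum_nat.const_mul κ).const_sub 1
  have tE := ((((hexp _ hY).1.div_const 2).hasSum.tendsto_sum_nat).const_mul κ).const_sub (M * h)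
  have tL := ((((tendsto_finsetSum (Finset.range M) fun N _ =>
    tP ((N + 1) * h) (by positivity)).add (((tP _ hY).const_sub 1).div_const 2)).const_mul h).sub
      tE).abs
  have tR : Tendsto (fun J : ℕ => h ^ 2 / 8 * (κ * C * (Real.pi + M * h / (J : ℝ) ^ 2))) atTop
      (nhds (h ^ 2 / 8 * (κ * C * (Real.pi + 0)))) := by
    refine Tendsto.const_mul _ (Tendsto.const_mul _ (Tendsto.const_add _ ?_))
    refine Tendsto.div_atTop tendsto_const_nhds ?_
    exact (tendsto_pow_atTop two_ne_zero).comp tendsto_natCast_atTop_atTop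
  refine (le_of_tendsto_of_tendsto tL tR ?_).trans (le_of_eq (by ring))
  filter_upwards [eventually_ge_atTop 1] with J hJ using key J hJ

/-- The lattice sum of `latticeDefect` with step `h` is `1 / (h √π) - 1/2` up to `O(h)` and
truncation terms. -/
theorem exists_sum_latticeDefect : ∃ C : ℝ, 0 < C ∧ ∀ h : ℝ, 0 < h → ∀ M : ℕ, 1 ≤ M →
    |∑ N ∈ Finset.range M, latticeDefect ((N + 1) * h) - (1 / (h * √Real.pi) - 1 / 2)|
      ≤ C * (h + 1 / (M * h) ^ 2 + 1 / (M * h ^ 2)) := by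
  have hpi : 0 < √Real.pi := Real.sqrt_pos.2 Real.pi_pos
  obtain ⟨A, hA, bA⟩ := exists_trapezoid_latticeDefect
  obtain ⟨B, hB, bB⟩ := exists_integral_latticeDefect_sub_le
  obtain ⟨D, hD, bD⟩ := exists_latticeDefect_le
  refine ⟨A + B + D, by positivity, fun h hh M hM => ?_⟩
  have hM0 : (0 : ℝ) < M := by exact_mod_cast hM
  have hY : 0 < M * h := by positivity
  have h1 := bA h hh M hM
  have h2 := (bB _ hY).2
  have h3 := bD _ hY
  set S := ∑ N ∈ Finset.range M, latticeDefect ((N + 1) * h)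
  set Q := M * h - 4 / √Real.pi * ∑' j : ℕ, Real.exp (-(((j : ℝ) + 1) * (M * h)⁻¹) ^ 2) / 2
  set p := latticeDefect (M * h)
  have e : S - (1 / (h * √Real.pi) - 1 / 2)
      = h⁻¹ * (h * (S + (1 - p) / 2) - Q) + h⁻¹ * (Q - 1 / √Real.pi) + p / 2 := by
    field_simp
    ring
  rw [e]
  refine (abs_add_three _ _ _).trans ?_
  rw [abs_mul, abs_mul, abs_of_pos (inv_pos.2 hh), abs_div, abs_of_pos (by norm_num : (0 : ℝ) < 2)]
  have t1 : h⁻¹ * |h * (S + (1 - p) / 2) - Q| ≤ A * h := by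
    calc _ ≤ h⁻¹ * (A * h ^ 2) := by gcongr
      _ = _ := by field_simp
  have t2 : h⁻¹ * |Q - 1 / √Real.pi| ≤ B * (1 / (M * h ^ 2)) := by
    calc _ ≤ h⁻¹ * (B / (M * h)) := by gcongr
      _ = _ := by field_simp
  have t3 : |p| / 2 ≤ D * (1 / (M * h) ^ 2) := by
    rw [mul_one_div]
    linarith [abs_nonneg p]
  have p1 : 0 < 1 / (M * h) ^ 2 := by positivity
  have p2 : 0 < 1 / (M * h ^ 2) := by positivity
  nlinarith [mul_pos hA p1, mul_pos hA p2, mul_pos hB p1, mul_pos hB hh, mul_pos hD hh,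
    mul_pos hD p2]

/-! ### Gaussian approximation of the spectral density -/

/-- The Gaussian profile `θ² exp (-(4n/5) θ²)` of the spectral density near `0`. -/
noncomputable def gaussBump (n : ℕ) (θ : ℝ) : ℝ := θ ^ 2 * Real.exp (-(4 / 5 * n * θ ^ 2))

/-- The derivative of `gaussBump n`. -/
noncomputable def gaussBump' (n : ℕ) (θ : ℝ) : ℝ :=
  (2 * θ - 8 / 5 * n * θ ^ 3) * Real.exp (-(4 / 5 * n * θ ^ 2))

/-- The second derivative of `gaussBump n`. -/
noncomputable def gaussBump'' (n : ℕ) (θ : ℝ) : ℝ :=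
  (2 - 8 * n * θ ^ 2 + 64 / 25 * n ^ 2 * θ ^ 4) * Real.exp (-(4 / 5 * n * θ ^ 2))

theorem hasDerivAt_poly_mul_gauss' {p p' : ℝ → ℝ} {x : ℝ} (c : ℝ) (hp : HasDerivAt p (p' x) x) :
    HasDerivAt (fun x => p x * Real.exp (-(c * x ^ 2)))
      ((p' x - 2 * c * x * p x) * Real.exp (-(c * x ^ 2))) x := by
  refine (hp.mul ((((hasDerivAt_pow 2 x).const_mul c).neg).exp)).congr_deriv ?_
  simp only [Pi.neg_apply]
  push_cast
  ring

theorem hasDerivAt_gaussBump (n : ℕ) (θ : ℝ) : HasDerivAt (gaussBump n) (gaussBump' n θ) θ := by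
  refine (hasDerivAt_poly_mul_gauss' (4 / 5 * n) (p := fun x => x ^ 2)
    (p' := fun x => 2 * x) ?_).congr_deriv ?_
  · simpa using hasDerivAt_pow 2 θ
  · simp only [gaussBump']; ring

theorem hasDerivAt_gaussBump' (n : ℕ) (θ : ℝ) : HasDerivAt (gaussBump' n) (gaussBump'' n θ) θ := by
  refine (hasDerivAt_poly_mul_gauss' (4 / 5 * n) (p := fun x => 2 * x - 8 / 5 * n * x ^ 3)
    (p' := fun x => 2 - 24 / 5 * n * x ^ 2) ?_).congr_deriv ?_
  · refine (((hasDerivAt_id' θ).const_mul 2).sub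
      ((hasDerivAt_pow 3 θ).const_mul (8 / 5 * (n : ℝ)))).congr_deriv ?_
    push_cast; ring
  · simp only [gaussBump'']; ring

namespace MultiEdgeTree

/-- The base of the power in the spectral density. -/
noncomputable def spectralBase (θ : ℝ) : ℝ := (1 + 4 * Real.cos θ ^ 2) / 5

/-- The derivative of `spectral (m + 3)`; the shift keeps the exponents of `spectralBase` free of
truncated subtraction. -/
noncomputable def spectral' (m : ℕ) (θ : ℝ) : ℝ :=
  2 * (Real.sin θ * Real.cos θ * (Real.cos θ ^ 2 - Real.sin θ ^ 2)) * spectralBase θ ^ (m + 2)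
    - 8 / 5 * (m + 2) * (Real.sin θ ^ 3 * Real.cos θ ^ 3) * spectralBase θ ^ (m + 1)

/-- The second derivative of `spectral (m + 3)`. -/
noncomputable def spectral'' (m : ℕ) (θ : ℝ) : ℝ :=
  (2 - 16 * Real.sin θ ^ 2 * Real.cos θ ^ 2) * spectralBase θ ^ (m + 2)
    + (m + 2) * (-8 * Real.sin θ ^ 2 * Real.cos θ ^ 2 * (Real.cos θ ^ 2 - Real.sin θ ^ 2))
      * spectralBase θ ^ (m + 1)
    + (m + 2) * (m + 1) * (64 / 25 * Real.sin θ ^ 4 * Real.cos θ ^ 4) * spectralBase θ ^ m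

theorem hasDerivAt_spectralBase (θ : ℝ) :
    HasDerivAt spectralBase (-(8 / 5) * (Real.sin θ * Real.cos θ)) θ := by
  refine (((((Real.hasDerivAt_cos θ).pow 2).const_mul 4).const_add 1).div_const 5).congr_deriv ?_
  push_cast; ring

theorem hasDerivAt_spectral (m : ℕ) (θ : ℝ) : HasDerivAt (spectral (m + 3)) (spectral' m θ) θ := by
  refine ((((Real.hasDerivAt_sin θ).pow 2).mul ((Real.hasDerivAt_cos θ).pow 2)).mul
    ((hasDerivAt_spectralBase θ).pow (m + 2))).congr_deriv ?_
  simp only [Pi.pow_apply, Pi.mul_apply, spectral']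
  rw [show m + 2 - 1 = m + 1 from rfl]
  push_cast; ring

theorem hasDerivAt_spectral' (m : ℕ) (θ : ℝ) : HasDerivAt (spectral' m) (spectral'' m θ) θ := by
  have hs := Real.hasDerivAt_sin θ
  have hc := Real.hasDerivAt_cos θ
  have hv := hasDerivAt_spectralBase θ
  refine ((((((hs.mul hc).mul ((hc.pow 2).sub (hs.pow 2))).const_mul 2).mul (hv.pow (m + 2)))).sub
    ((((hs.pow 3).mul (hc.pow 3)).const_mul (8 / 5 * ((m : ℝ) + 2))).mul
      (hv.pow (m + 1)))).congr_deriv ?_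
  simp only [Pi.pow_apply, Pi.mul_apply, Pi.sub_apply, spectral'']
  rw [show m + 2 - 1 = m + 1 from rfl, show m + 1 - 1 = m from rfl]
  have h1 : Real.sin θ ^ 2 = 1 - Real.cos θ ^ 2 := Real.sin_sq θ
  set s := Real.sin θ
  set c := Real.cos θ
  push_cast
  linear_combination (2 * spectralBase θ ^ (m + 2) * (s ^ 2 + c ^ 2 + 1)) * h1

theorem continuous_spectral'' (m : ℕ) : Continuous (spectral'' m) := by
  unfold spectral'' spectralBase; fun_prop

/-- What is left of the spectral density for size `m + 3` after subtracting the Gaussian profiles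
at `0` and `π`. -/
noncomputable def remainder (m : ℕ) (θ : ℝ) : ℝ :=
  spectral (m + 3) θ - gaussBump (m + 3) θ - gaussBump (m + 3) (Real.pi - θ)

/-- The derivative of `remainder m`. -/
noncomputable def remainder' (m : ℕ) (θ : ℝ) : ℝ :=
  spectral' m θ - gaussBump' (m + 3) θ + gaussBump' (m + 3) (Real.pi - θ)

/-- The second derivative of `remainder m`. -/
noncomputable def remainder'' (m : ℕ) (θ : ℝ) : ℝ :=
  spectral'' m θ - gaussBump'' (m + 3) θ - gaussBump'' (m + 3) (Real.pi - θ)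

theorem hasDerivAt_remainder (m : ℕ) (θ : ℝ) : HasDerivAt (remainder m) (remainder' m θ) θ := by
  refine (((hasDerivAt_spectral m θ).sub (hasDerivAt_gaussBump (m + 3) θ)).sub
    ((hasDerivAt_gaussBump (m + 3) (Real.pi - θ)).comp_const_sub Real.pi θ)).congr_deriv ?_
  simp only [remainder']; ring

theorem hasDerivAt_remainder' (m : ℕ) (θ : ℝ) : HasDerivAt (remainder' m) (remainder'' m θ) θ := by
  refine (((hasDerivAt_spectral' m θ).sub (hasDerivAt_gaussBump' (m + 3) θ)).add
    ((hasDerivAt_gaussBump' (m + 3) (Real.pi - θ)).comp_const_sub Real.pi θ)).congr_deriv ?_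
  simp only [remainder'']; ring

theorem continuous_remainder'' (m : ℕ) : Continuous (remainder'' m) := by
  have := continuous_spectral'' m
  unfold remainder'' gaussBump''; fun_prop

theorem remainder_pi_sub (m : ℕ) (θ : ℝ) : remainder m (Real.pi - θ) = remainder m θ := by
  simp only [remainder, spectral, Real.sin_pi_sub, Real.cos_pi_sub, neg_sq, sub_sub_cancel]
  ring

theorem remainder''_pi_sub (m : ℕ) (θ : ℝ) : remainder'' m (Real.pi - θ) = remainder'' m θ := by
  simp only [remainder'', spectral'', spectralBase, Real.sin_pi_sub, Real.cos_pi_sub, neg_sq,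
    sub_sub_cancel, Even.neg_pow (show Even 4 by decide)]
  ring

end MultiEdgeTree

theorem sq_sub_sin_sq_mem {θ : ℝ} (h0 : 0 ≤ θ) (h1 : θ ≤ Real.pi / 2) :
    0 ≤ θ ^ 2 - Real.sin θ ^ 2 ∧ θ ^ 2 - Real.sin θ ^ 2 ≤ θ ^ 4 := by
  have hs := Real.sin_le h0
  have hs0 := Real.sin_nonneg_of_nonneg_of_le_pi h0 (by linarith [Real.pi_pos])
  have hc0 := Real.cos_nonneg_of_neg_pi_div_two_le_of_le (x := θ) (by linarith [Real.pi_pos]) h1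
  have hs2 : Real.sin θ ^ 2 ≤ θ ^ 2 := pow_le_pow_left₀ hs0 hs 2
  refine ⟨by linarith, ?_⟩
  have hle : θ * Real.cos θ ≤ Real.sin θ := by
    rcases h0.eq_or_lt with rfl | h0
    · simp
    rcases h1.eq_or_lt with rfl | h1
    · simp
    have hc := Real.cos_pos_of_mem_Ioo (x := θ) ⟨by linarith, h1⟩
    have := Real.lt_tan h0 h1
    rw [Real.tan_eq_sin_div_cos, lt_div_iff₀ hc] at this
    exact this.le
  have h2 : (θ * Real.cos θ) ^ 2 ≤ Real.sin θ ^ 2 := pow_le_pow_left₀ (by positivity) hle 2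
  have h3 : Real.cos θ ^ 2 = 1 - Real.sin θ ^ 2 := Real.cos_sq' θ
  rw [mul_pow, h3] at h2
  nlinarith [mul_le_mul_of_nonneg_left hs2 (sq_nonneg θ)]

namespace MultiEdgeTree

theorem spectralBase_eq (θ : ℝ) : spectralBase θ = 1 - 4 / 5 * Real.sin θ ^ 2 := by
  rw [spectralBase, Real.cos_sq']; ring

theorem spectralBase_nonneg (θ : ℝ) : 0 ≤ spectralBase θ := by unfold spectralBase; positivity

theorem spectralBase_le {θ : ℝ} (h0 : 0 ≤ θ) (h1 : θ ≤ Real.pi / 2) :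
    spectralBase θ ≤ Real.exp (-(θ ^ 2 / 4)) := by
  have h2 := Real.mul_le_sin h0 h1
  have h3 : (2 / Real.pi * θ) ^ 2 ≤ Real.sin θ ^ 2 :=
    pow_le_pow_left₀ (mul_nonneg (div_nonneg (by norm_num) Real.pi_pos.le) h0) h2 2
  have h4 : (2 / Real.pi) ^ 2 ≥ 2 / 5 := by
    rw [div_pow, ge_iff_le, div_le_div_iff₀ (by norm_num) (by positivity)]
    nlinarith [Real.pi_lt_d2, Real.pi_pos]
  rw [mul_pow] at h3
  have h5 : 2 / 5 * θ ^ 2 ≤ Real.sin θ ^ 2 :=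
    (mul_le_mul_of_nonneg_right h4 (sq_nonneg θ)).trans h3
  rw [spectralBase_eq]
  have h6 := Real.add_one_le_exp (-(θ ^ 2 / 4))
  nlinarith [sq_nonneg θ]

theorem abs_spectralBase_sub_le {θ : ℝ} (h0 : 0 ≤ θ) (h1 : θ ≤ Real.pi / 2) :
    |spectralBase θ - Real.exp (-(4 / 5 * θ ^ 2))| ≤ 2 * θ ^ 4 := by
  obtain ⟨h2, h3⟩ := sq_sub_sin_sq_mem h0 h1
  have h4 := Real.add_one_le_exp (-(4 / 5 * θ ^ 2))
  have h5 : Real.exp (-(4 / 5 * θ ^ 2)) ≤ 1 - 4 / 5 * θ ^ 2 + (4 / 5 * θ ^ 2) ^ 2 := by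
    have hx : 0 ≤ 4 / 5 * θ ^ 2 := by positivity
    set x := 4 / 5 * θ ^ 2
    have h6 := Real.quadratic_le_exp_of_nonneg hx
    rw [Real.exp_neg, inv_le_iff_one_le_mul₀ (Real.exp_pos x)]
    have h7 : 0 ≤ 1 - x + x ^ 2 := by nlinarith [sq_nonneg (x - 1)]
    have h8 := mul_le_mul_of_nonneg_left h6 h7
    nlinarith [pow_nonneg hx 3, pow_nonneg hx 4, sq_nonneg x]
  rw [spectralBase_eq, abs_le]
  constructor <;> nlinarith [sq_nonneg (θ ^ 2)]

/-- Powers of `spectralBase` with an exponent near `n`, compared with the Gaussian factor. -/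
theorem abs_spectralBase_pow_sub_le {θ : ℝ} (h0 : 0 ≤ θ) (h1 : θ ≤ Real.pi / 2) {k n : ℕ}
    (hkn : k ≤ n) (hnk : n ≤ k + 3) :
    |spectralBase θ ^ k - Real.exp (-(4 / 5 * n * θ ^ 2))| ≤
      3 * Real.exp 4 * (n * θ ^ 4 + θ ^ 2) * Real.exp (-(n * θ ^ 2 / 4)) := by
  have hθ2 : θ ^ 2 ≤ 4 := by
    have : θ ≤ 2 := by linarith [Real.pi_le_four]
    nlinarith
  have hkn' : (k : ℝ) ≤ n := by exact_mod_cast hkn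
  have hnk' : (n : ℝ) ≤ k + 3 := by exact_mod_cast hnk
  set w := Real.exp (-(4 / 5 * θ ^ 2)) with hw
  set u := Real.exp (-(θ ^ 2 / 4)) with hu
  have hw0 : 0 < w := Real.exp_pos _
  have hwu : w ≤ u := Real.exp_le_exp.2 (by nlinarith [sq_nonneg θ])
  have hv0 := spectralBase_nonneg θ
  have hvu : spectralBase θ ≤ u := spectralBase_le h0 h1
  have hpow : ∀ j : ℕ, n ≤ j + 4 → u ^ j ≤ Real.exp 4 * Real.exp (-(n * θ ^ 2 / 4)) := by
    intro j hj
    have hj' : (n : ℝ) ≤ j + 4 := by exact_mod_cast hj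
    rw [hu, ← Real.exp_nat_mul, ← Real.exp_add, Real.exp_le_exp]
    nlinarith [sq_nonneg θ, mul_le_mul_of_nonneg_right hj' (sq_nonneg θ)]
  have hW : Real.exp (-(4 / 5 * n * θ ^ 2)) = w ^ k * w ^ (n - k) := by
    rw [← pow_add, Nat.add_sub_cancel' hkn, hw, ← Real.exp_nat_mul]; ring_nf
  have t1 : |spectralBase θ ^ k - w ^ k| ≤
      2 * n * θ ^ 4 * (Real.exp 4 * Real.exp (-(n * θ ^ 2 / 4))) := by
    refine (abs_pow_sub_pow_le _ _ k).trans ?_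
    have e1 : max |spectralBase θ| |w| ^ (k - 1) ≤ Real.exp 4 * Real.exp (-(n * θ ^ 2 / 4)) := by
      refine le_trans (pow_le_pow_left₀ (le_max_of_le_left (abs_nonneg _)) ?_ _)
        (hpow (k - 1) (by omega))
      rw [abs_of_nonneg hv0, abs_of_pos hw0]
      exact max_le hvu hwu
    calc _ ≤ (2 * θ ^ 4) * n * (Real.exp 4 * Real.exp (-(n * θ ^ 2 / 4))) := by
          gcongr
          exact abs_spectralBase_sub_le h0 h1
      _ = _ := by ring
  have t2 : |w ^ k - w ^ k * w ^ (n - k)| ≤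
      3 * θ ^ 2 * (Real.exp 4 * Real.exp (-(n * θ ^ 2 / 4))) := by
    have e1 : w ^ k ≤ Real.exp 4 * Real.exp (-(n * θ ^ 2 / 4)) :=
      (pow_le_pow_left₀ hw0.le hwu k).trans (hpow k (by omega))
    have e2 : |1 - w ^ (n - k)| ≤ 3 * θ ^ 2 := by
      have e3 : w ^ (n - k) = Real.exp (((n - k : ℕ) : ℝ) * -(4 / 5 * θ ^ 2)) := by
        rw [hw, Real.exp_nat_mul]
      have e4 : ((n - k : ℕ) : ℝ) ≤ 3 := by rw [Nat.cast_sub hkn]; linarith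
      have e5 := Real.add_one_le_exp (((n - k : ℕ) : ℝ) * -(4 / 5 * θ ^ 2))
      rw [← e3] at e5
      have e6 : w ^ (n - k) ≤ 1 := by
        refine pow_le_one₀ hw0.le ?_
        rw [hw, Real.exp_le_one_iff]
        nlinarith [sq_nonneg θ]
      rw [abs_of_nonneg (by linarith)]
      nlinarith [sq_nonneg θ, mul_le_mul_of_nonneg_right e4 (sq_nonneg θ)]
    calc |w ^ k - w ^ k * w ^ (n - k)| = |1 - w ^ (n - k)| * w ^ k := by
          rw [← mul_one_sub, abs_mul, abs_of_pos (pow_pos hw0 k), mul_comm]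
      _ ≤ _ := by gcongr
  rw [hW]
  refine (abs_sub_le _ (w ^ k) _).trans ((add_le_add t1 t2).trans ?_)
  have : 0 ≤ n * θ ^ 4 * (Real.exp 4 * Real.exp (-(n * θ ^ 2 / 4))) := by positivity
  linarith

end MultiEdgeTree

namespace MultiEdgeTree

theorem abs_spectral_sub_gaussBump_le {θ : ℝ} (h0 : 0 ≤ θ) (h1 : θ ≤ Real.pi / 2) (m : ℕ) {n X : ℝ}
    (hn : n = ((m + 3 : ℕ) : ℝ)) (hX : X = n * θ ^ 2) :
    |spectral (m + 3) θ - gaussBump (m + 3) θ| ≤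
      (3 * Real.exp 4 + 2) / n ^ 2 * ((1 + X) ^ 5 * Real.exp (-(1 / 4 * X))) := by
  have hn0 : 0 < n := by rw [hn]; positivity
  have hX0 : 0 ≤ X := by rw [hX]; positivity
  obtain ⟨hs1, hs2⟩ := sq_sub_sin_sq_mem h0 h1
  have hV := abs_spectralBase_pow_sub_le h0 h1 (k := m + 2) (n := m + 3) (by omega) (by omega)
  rw [← hn] at hV
  set E := Real.exp (-(1 / 4 * X)) with hE
  set W := Real.exp (-(4 / 5 * n * θ ^ 2)) with hW
  have eE : Real.exp (-(n * θ ^ 2 / 4)) = E := by rw [hE, hX]; ring_nf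
  have hWE : W ≤ E := Real.exp_le_exp.2 (by nlinarith)
  have hW0 : 0 < W := Real.exp_pos _
  have hθ : θ ^ 2 = X / n := by rw [hX]; field_simp
  have hθ4 : θ ^ 4 = X ^ 2 / n ^ 2 := by rw [show θ ^ 4 = (θ ^ 2) ^ 2 by ring, hθ, div_pow]
  rw [eE, hθ4, hθ] at hV
  have hc : Real.cos θ ^ 2 = 1 - Real.sin θ ^ 2 := Real.cos_sq' θ
  have hsc0 : 0 ≤ Real.sin θ ^ 2 * Real.cos θ ^ 2 := by positivity
  have hsc1 : Real.sin θ ^ 2 * Real.cos θ ^ 2 ≤ θ ^ 2 := by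
    nlinarith [sq_nonneg (Real.sin θ), sq_nonneg (Real.sin θ ^ 2)]
  have hsc2 : |Real.sin θ ^ 2 * Real.cos θ ^ 2 - θ ^ 2| ≤ 2 * θ ^ 4 := by
    rw [hc, abs_le]
    constructor <;> nlinarith [sq_nonneg (Real.sin θ), sq_nonneg (Real.sin θ ^ 2),
      mul_nonneg (sq_nonneg (Real.sin θ)) hs1, mul_nonneg (sq_nonneg θ) hs1]
  have e : spectral (m + 3) θ - gaussBump (m + 3) θ
      = Real.sin θ ^ 2 * Real.cos θ ^ 2 * (spectralBase θ ^ (m + 2) - W)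
        + (Real.sin θ ^ 2 * Real.cos θ ^ 2 - θ ^ 2) * W := by
    rw [spectral, gaussBump, ← hn, ← hW, ← spectralBase]
    rw [show m + 3 - 1 = m + 2 from rfl]
    ring
  rw [e]
  refine (abs_add_le _ _).trans ?_
  rw [abs_mul (_ * _), abs_mul (_ - _), abs_of_nonneg hsc0, abs_of_pos hW0]
  have hE0 : 0 < E := Real.exp_pos _
  calc _ ≤ θ ^ 2 * (3 * Real.exp 4 * (n * (X ^ 2 / n ^ 2) + X / n) * E) + 2 * θ ^ 4 * E := by
        gcongr
    _ = 1 / n ^ 2 * (3 * Real.exp 4 * (X ^ 3 + X ^ 2) + 2 * X ^ 2) * E := by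
        rw [hθ4, hθ]; field_simp
    _ ≤ 1 / n ^ 2 * (3 * Real.exp 4 * (1 + X) ^ 5 + 2 * (1 + X) ^ 5) * E := by
        have a1 : X ^ 2 ≤ (1 + X) ^ 5 := by
          calc X ^ 2 ≤ (1 + X) ^ 2 := by gcongr; linarith
            _ ≤ (1 + X) ^ 5 := pow_le_pow_right₀ (by linarith) (by norm_num)
        have a2 : X ^ 3 + X ^ 2 ≤ (1 + X) ^ 5 := by
          calc X ^ 3 + X ^ 2 ≤ (1 + X) ^ 3 := by nlinarith [pow_nonneg hX0 2]
            _ ≤ (1 + X) ^ 5 := pow_le_pow_right₀ (by linarith) (by norm_num)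
        gcongr
    _ = _ := by ring

/-- The coefficients in the second derivative of the spectral density, as functions of
`a = sin² θ`, against their leading terms in `T = θ²`. -/
theorem abs_spectral_coeff_le {a T : ℝ} (ha0 : 0 ≤ a) (ha1 : a ≤ 1) (haT : a ≤ T)
    (hTa : T - a ≤ T ^ 2) :
    |2 - 16 * a * (1 - a)| ≤ 4 ∧ |-8 * a * (1 - a) * ((1 - a) - a)| ≤ 8 * T ∧
    |64 / 25 * a ^ 2 * (1 - a) ^ 2| ≤ 3 * T ^ 2 ∧ |2 - 16 * a * (1 - a) - 2| ≤ 16 * T ∧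
    |-8 * a * (1 - a) * ((1 - a) - a) + 8 * T| ≤ 32 * T ^ 2 ∧
    |(a * (1 - a)) ^ 2 - T ^ 2| ≤ 4 * T ^ 3 := by
  have hT0 : 0 ≤ T := ha0.trans haT
  have hp0 : 0 ≤ a * (1 - a) := mul_nonneg ha0 (by linarith)
  have hp1 : a * (1 - a) ≤ 1 / 4 := by nlinarith [sq_nonneg (a - 1 / 2)]
  have hp2 : a * (1 - a) ≤ T := by nlinarith
  have ha2 : a ^ 2 ≤ T ^ 2 := pow_le_pow_left₀ ha0 haT 2
  have ha3 : 0 ≤ a ^ 3 := pow_nonneg ha0 3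
  have ha32 : a ^ 3 ≤ a ^ 2 := pow_le_pow_of_le_one ha0 ha1 (by norm_num)
  refine ⟨?_, ?_, ?_, ?_, ?_, ?_⟩
  · rw [abs_le]; constructor <;> linarith
  · have h1 := mul_nonneg hp0 ha0
    have h2 := mul_nonneg hp0 (sub_nonneg.2 ha1)
    rw [abs_le]; constructor <;> linarith
  · have e : 64 / 25 * a ^ 2 * (1 - a) ^ 2 = 64 / 25 * (a * (1 - a)) ^ 2 := by ring
    rw [e, abs_of_nonneg (by positivity)]
    have := pow_le_pow_left₀ hp0 hp2 2
    linarith [sq_nonneg T]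
  · rw [abs_le]; constructor <;> linarith
  · have e : -8 * a * (1 - a) * ((1 - a) - a) + 8 * T = 8 * (T - a) + 24 * a ^ 2 - 16 * a ^ 3 := by
      ring
    rw [e, abs_le]
    constructor <;> linarith
  · have e : (a * (1 - a)) ^ 2 - T ^ 2 = -((T - a * (1 - a)) * (T + a * (1 - a))) := by ring
    have h6 : T - a * (1 - a) ≤ 2 * T ^ 2 := by linarith
    rw [e, abs_neg, abs_of_nonneg (mul_nonneg (by linarith) (by positivity))]
    calc _ ≤ 2 * T ^ 2 * (T + T) := by gcongr
      _ = _ := by ring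

theorem poly_le_one_add_pow {X : ℝ} (hX : 0 ≤ X) :
    (4 + 8 * X + 3 * X ^ 2) * (X ^ 2 + X) ≤ 33 * (1 + X) ^ 5 ∧
    24 * X + 41 * X ^ 2 + 12 * X ^ 3 ≤ 100 * (1 + X) ^ 5 := by
  have p2 := pow_nonneg hX 2
  have p3 := pow_nonneg hX 3
  have p4 := pow_nonneg hX 4
  have p5 := pow_nonneg hX 5
  constructor <;> linarith

theorem abs_spectral''_sub_gaussBump''_le {θ : ℝ} (h0 : 0 ≤ θ) (h1 : θ ≤ Real.pi / 2) (m : ℕ)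
    {n X : ℝ} (hn : n = ((m + 3 : ℕ) : ℝ)) (hX : X = n * θ ^ 2) :
    |spectral'' m θ - gaussBump'' (m + 3) θ| ≤
      (100 * Real.exp 4 + 100) / n * ((1 + X) ^ 5 * Real.exp (-(1 / 4 * X))) := by
  have hn3 : n = m + 3 := by rw [hn]; push_cast; ring
  have hm0 : (0 : ℝ) ≤ m := Nat.cast_nonneg m
  have hn0 : 0 < n := by rw [hn]; positivity
  have hX0 : 0 ≤ X := by rw [hX]; positivity
  obtain ⟨hs1, hs2⟩ := sq_sub_sin_sq_mem h0 h1
  have hV2 := abs_spectralBase_pow_sub_le h0 h1 (k := m + 2) (n := m + 3) (by omega) (by omega)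
  have hV1 := abs_spectralBase_pow_sub_le h0 h1 (k := m + 1) (n := m + 3) (by omega) (by omega)
  have hV0 := abs_spectralBase_pow_sub_le h0 h1 (k := m) (n := m + 3) (by omega) (by omega)
  rw [← hn] at hV2 hV1 hV0
  set E := Real.exp (-(1 / 4 * X)) with hE
  set W := Real.exp (-(4 / 5 * n * θ ^ 2)) with hW
  have eE : Real.exp (-(n * θ ^ 2 / 4)) = E := by rw [hE, hX]; ring_nf
  have hWE : W ≤ E := Real.exp_le_exp.2 (by nlinarith)
  have hW0 : 0 < W := Real.exp_pos _
  have hE0 : 0 < E := Real.exp_pos _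
  have hθ : θ ^ 2 = X / n := by rw [hX]; field_simp
  have hθ4 : θ ^ 4 = X ^ 2 / n ^ 2 := by rw [show θ ^ 4 = (θ ^ 2) ^ 2 by ring, hθ, div_pow]
  have hθ6 : θ ^ 6 = X ^ 3 / n ^ 3 := by rw [show θ ^ 6 = (θ ^ 2) ^ 3 by ring, hθ, div_pow]
  have eD : 3 * Real.exp 4 * (n * (X ^ 2 / n ^ 2) + X / n) * E
      = 3 * Real.exp 4 / n * (X ^ 2 + X) * E := by field_simp
  rw [eE, hθ4, hθ, eD] at hV2 hV1 hV0
  set D := 3 * Real.exp 4 / n * (X ^ 2 + X) * E with hD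
  have hc : Real.cos θ ^ 2 = 1 - Real.sin θ ^ 2 := Real.cos_sq' θ
  have hs0 := sq_nonneg (Real.sin θ)
  have hs1' : Real.sin θ ^ 2 ≤ 1 := Real.sin_sq_le_one θ
  set a := Real.sin θ ^ 2 with ha
  -- the three coefficients and their Gaussian counterparts
  set α := 2 - 16 * a * (1 - a) with hα
  set β := -8 * a * (1 - a) * ((1 - a) - a) with hβ
  set γ := 64 / 25 * a ^ 2 * (1 - a) ^ 2 with hγ
  obtain ⟨bα, bβ', bγ', cα', cβ', cγ'⟩ := abs_spectral_coeff_le (a := a) (T := θ ^ 2) hs0 hs1'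
    (by linarith) (by linarith [show (θ ^ 2) ^ 2 = θ ^ 4 by ring])
  rw [← hα] at bα cα'
  rw [← hβ] at bβ' cβ'
  rw [← hγ] at bγ'
  have e : spectral'' m θ - gaussBump'' (m + 3) θ
      = α * (spectralBase θ ^ (m + 2) - W) + (n - 1) * β * (spectralBase θ ^ (m + 1) - W)
        + (n - 1) * (n - 2) * γ * (spectralBase θ ^ m - W)
        + ((α - 2) + ((n - 1) * β + 8 * n * θ ^ 2)
          + ((n - 1) * (n - 2) * γ - 64 / 25 * n ^ 2 * θ ^ 4)) * W := by
    rw [spectral'', gaussBump'', ← hn, ← hW, hα, hβ, hγ, ← hc, ha, hn3]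
    ring
  have n1 : |n - 1| ≤ n := by rw [abs_le]; constructor <;> linarith
  have n2 : |n - 2| ≤ n := by rw [abs_le]; constructor <;> linarith
  have n12 : |(n - 1) * (n - 2)| ≤ n ^ 2 := by
    rw [abs_mul, sq]
    gcongr
  have bβ : |(n - 1) * β| ≤ 8 * X := by
    rw [abs_mul]
    calc _ ≤ n * (8 * θ ^ 2) := by gcongr
      _ = _ := by rw [hX]; ring
  have bγ : |(n - 1) * (n - 2) * γ| ≤ 3 * X ^ 2 := by
    rw [abs_mul]
    calc _ ≤ n ^ 2 * (3 * (θ ^ 2) ^ 2) := by gcongr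
      _ = _ := by rw [hX]; ring
  have cα : |α - 2| ≤ 16 * (X / n) := by rw [← hθ]; exact cα'
  have cβ : |(n - 1) * β + 8 * n * θ ^ 2| ≤ (32 * X ^ 2 + 8 * X) / n := by
    have : (n - 1) * β + 8 * n * θ ^ 2 = (n - 1) * (β + 8 * θ ^ 2) + 8 * θ ^ 2 := by ring
    rw [this]
    refine (abs_add_le _ _).trans ?_
    rw [abs_mul, abs_of_nonneg (by positivity : 0 ≤ 8 * θ ^ 2)]
    calc _ ≤ n * (32 * (θ ^ 2) ^ 2) + 8 * θ ^ 2 := by gcongr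
      _ = _ := by rw [hθ]; field_simp
  have cγ : |(n - 1) * (n - 2) * γ - 64 / 25 * n ^ 2 * θ ^ 4| ≤ (12 * X ^ 3 + 9 * X ^ 2) / n := by
    have h5 : |(a * (1 - a)) ^ 2 - θ ^ 4| ≤ 4 * θ ^ 6 := by convert cγ' using 2 <;> ring_nf
    have : (n - 1) * (n - 2) * γ - 64 / 25 * n ^ 2 * θ ^ 4
        = 64 / 25 * ((n - 1) * (n - 2)) * ((a * (1 - a)) ^ 2 - θ ^ 4)
          + 64 / 25 * (2 - 3 * n) * θ ^ 4 := by rw [hγ]; ring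
    rw [this]
    refine (abs_add_le _ _).trans ?_
    rw [abs_mul _ (_ - _), abs_mul _ ((n - 1) * (n - 2)), abs_mul _ (θ ^ 4), abs_mul _ (2 - 3 * n),
      abs_of_nonneg (by positivity : 0 ≤ θ ^ 4), abs_of_pos (by norm_num : (0 : ℝ) < 64 / 25)]
    have n3 : |2 - 3 * n| ≤ 3 * n := by rw [abs_le]; constructor <;> linarith
    have n3' : 64 / 25 * |2 - 3 * n| ≤ 9 * n := by linarith
    calc _ ≤ 3 * n ^ 2 * (4 * θ ^ 6) + 9 * n * θ ^ 4 := by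
          gcongr
          norm_num
      _ = _ := by rw [hθ4, hθ6]; field_simp; ring
  rw [e]
  have hD0 : 0 ≤ D := by rw [hD]; positivity
  have T1 : |α * (spectralBase θ ^ (m + 2) - W)| ≤ 4 * D := by
    rw [abs_mul]; gcongr
  have T2 : |(n - 1) * β * (spectralBase θ ^ (m + 1) - W)| ≤ 8 * X * D := by
    rw [abs_mul]; gcongr
  have T3 : |(n - 1) * (n - 2) * γ * (spectralBase θ ^ m - W)| ≤ 3 * X ^ 2 * D := by
    rw [abs_mul]; gcongr
  have T4 : |((α - 2) + ((n - 1) * β + 8 * n * θ ^ 2)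
          + ((n - 1) * (n - 2) * γ - 64 / 25 * n ^ 2 * θ ^ 4)) * W| ≤
      (16 * (X / n) + (32 * X ^ 2 + 8 * X) / n + (12 * X ^ 3 + 9 * X ^ 2) / n) * E := by
    rw [abs_mul, abs_of_pos hW0]
    gcongr
    exact (abs_add_three _ _ _).trans (by linarith)
  calc _ ≤ 4 * D + 8 * X * D + 3 * X ^ 2 * D +
      (16 * (X / n) + (32 * X ^ 2 + 8 * X) / n + (12 * X ^ 3 + 9 * X ^ 2) / n) * E := by
        refine (abs_add_le _ _).trans (add_le_add ((abs_add_three _ _ _).trans ?_) T4)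
        linarith
    _ = 1 / n * (3 * Real.exp 4 * ((4 + 8 * X + 3 * X ^ 2) * (X ^ 2 + X))
        + (24 * X + 41 * X ^ 2 + 12 * X ^ 3)) * E := by
        rw [hD]; field_simp; ring
    _ ≤ 1 / n * (3 * Real.exp 4 * (33 * (1 + X) ^ 5) + 100 * (1 + X) ^ 5) * E := by
        obtain ⟨a1, a2⟩ := poly_le_one_add_pow hX0
        gcongr
    _ ≤ _ := by
        have : 1 / n * (3 * Real.exp 4 * (33 * (1 + X) ^ 5) + 100 * (1 + X) ^ 5) * E
          = (99 * Real.exp 4 + 100) / n * ((1 + X) ^ 5 * E) := by ring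
        rw [this]
        gcongr
        norm_num

/-- Away from `0`, where `n ≤ Y`, the Gaussian decay absorbs powers of `n`. -/
theorem abs_gaussBump_far_le {n : ℕ} {φ Y : ℝ} (hφ : 1 ≤ φ ^ 2) (hY : Y = n * φ ^ 2) (hn : 1 ≤ n) :
    |gaussBump n φ| ≤ 1 / (n : ℝ) ^ 2 * ((1 + Y) ^ 5 * Real.exp (-(1 / 4 * Y))) ∧
    |gaussBump n φ| ≤ 1 / (n : ℝ) ^ 3 * ((1 + Y) ^ 5 * Real.exp (-(1 / 4 * Y))) ∧
    |gaussBump'' n φ| ≤ 8 / (n : ℝ) * ((1 + Y) ^ 5 * Real.exp (-(1 / 4 * Y))) := by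
  have hn0 : (1 : ℝ) ≤ n := by exact_mod_cast hn
  have hn1 : (0 : ℝ) < n := by linarith
  have hYn : n ≤ Y := by rw [hY]; nlinarith
  have hY0 : 0 ≤ Y := by linarith
  have hφY : φ ^ 2 = Y / n := by rw [hY]; field_simp
  have hφY4 : φ ^ 4 = Y ^ 2 / n ^ 2 := by rw [show φ ^ 4 = (φ ^ 2) ^ 2 by ring, hφY, div_pow]
  have hW : Real.exp (-(4 / 5 * n * φ ^ 2)) ≤ Real.exp (-(1 / 4 * Y)) :=
    Real.exp_le_exp.2 (by rw [hY]; nlinarith)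
  have b3 : |gaussBump n φ| ≤ 1 / (n : ℝ) ^ 3 * ((1 + Y) ^ 5 * Real.exp (-(1 / 4 * Y))) := by
    rw [gaussBump, abs_of_nonneg (by positivity), hφY, ← hφY]
    calc φ ^ 2 * Real.exp (-(4 / 5 * n * φ ^ 2)) ≤ φ ^ 2 * Real.exp (-(1 / 4 * Y)) := by gcongr
      _ = 1 / (n : ℝ) ^ 3 * ((n ^ 2 * Y) * Real.exp (-(1 / 4 * Y))) := by rw [hφY]; field_simp
      _ ≤ _ := by
        gcongr
        calc n ^ 2 * Y ≤ Y ^ 2 * Y := by gcongr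
          _ = Y ^ 3 := by ring
          _ ≤ (1 + Y) ^ 3 := by gcongr; linarith
          _ ≤ (1 + Y) ^ 5 := pow_le_pow_right₀ (by linarith) (by norm_num)
  refine ⟨b3.trans ?_, b3, ?_⟩
  · have : 1 / (n : ℝ) ^ 3 ≤ 1 / (n : ℝ) ^ 2 :=
      one_div_le_one_div_of_le (by positivity) (pow_le_pow_right₀ hn0 (by norm_num))
    gcongr
  · have p2 := pow_nonneg hY0 2
    have p3 := pow_nonneg hY0 3
    have p4 := pow_nonneg hY0 4
    have p5 := pow_nonneg hY0 5
    have e : (2 - 8 * n * φ ^ 2 + 64 / 25 * n ^ 2 * φ ^ 4) = 2 - 8 * Y + 64 / 25 * Y ^ 2 := by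
      rw [hφY4, hφY]; field_simp
    rw [gaussBump'', e, abs_mul, abs_of_pos (Real.exp_pos _)]
    have h1 : |2 - 8 * Y + 64 / 25 * Y ^ 2| ≤ 2 + 8 * Y + 3 * Y ^ 2 := by
      rw [abs_le]; constructor <;> nlinarith
    calc _ ≤ (2 + 8 * Y + 3 * Y ^ 2) * Real.exp (-(1 / 4 * Y)) := by gcongr
      _ = 1 / (n : ℝ) * (n * (2 + 8 * Y + 3 * Y ^ 2) * Real.exp (-(1 / 4 * Y))) := by field_simp
      _ ≤ 1 / (n : ℝ) * (Y * (2 + 8 * Y + 3 * Y ^ 2) * Real.exp (-(1 / 4 * Y))) := by gcongr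
      _ ≤ 1 / (n : ℝ) * (8 * (1 + Y) ^ 5 * Real.exp (-(1 / 4 * Y))) := by
        have hpoly : Y * (2 + 8 * Y + 3 * Y ^ 2) ≤ 8 * (1 + Y) ^ 5 := by nlinarith
        exact mul_le_mul_of_nonneg_left
          (mul_le_mul_of_nonneg_right hpoly (Real.exp_pos _).le) (by positivity)
      _ = _ := by ring

/-- The remainder is smaller than the Gaussian profile by a factor `1 / n`, and so is its second
derivative. -/
theorem exists_remainder_le : ∃ C : ℝ, 0 < C ∧ ∀ (m : ℕ) (θ : ℝ), 0 ≤ θ → θ ≤ Real.pi →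
    |remainder m θ| ≤ C / ((m + 3 : ℕ) : ℝ) ^ 2 * (1 / (1 + ((m + 3 : ℕ) : ℝ) * θ ^ 2)
      + 1 / (1 + ((m + 3 : ℕ) : ℝ) * (Real.pi - θ) ^ 2)) ∧
    |remainder'' m θ| ≤ C / ((m + 3 : ℕ) : ℝ) * (1 / (1 + ((m + 3 : ℕ) : ℝ) * θ ^ 2)
      + 1 / (1 + ((m + 3 : ℕ) : ℝ) * (Real.pi - θ) ^ 2)) := by
  obtain ⟨B, hB, bB⟩ := exists_one_add_pow_mul_exp_neg_le 5 1 (c := 1 / 4) (by norm_num)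
  refine ⟨(100 * Real.exp 4 + 108) * B, by positivity, fun m => ?_⟩
  set n : ℝ := ((m + 3 : ℕ) : ℝ) with hn
  have hn0 : 0 < n := by rw [hn]; positivity
  have half : ∀ θ : ℝ, 0 ≤ θ → θ ≤ Real.pi / 2 →
      |remainder m θ| ≤ (100 * Real.exp 4 + 108) * B / n ^ 2 * (1 / (1 + n * θ ^ 2)) ∧
      |remainder'' m θ| ≤ (100 * Real.exp 4 + 108) * B / n * (1 / (1 + n * θ ^ 2)) := by
    intro θ h0 h1
    have hφ : 1 ≤ (Real.pi - θ) ^ 2 := by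
      have : 1 ≤ Real.pi - θ := by linarith [Real.pi_gt_three]
      nlinarith
    have hXY : n * θ ^ 2 ≤ n * (Real.pi - θ) ^ 2 := by
      have : θ ^ 2 ≤ (Real.pi - θ) ^ 2 := pow_le_pow_left₀ h0 (by linarith) 2
      gcongr
    have hX0 : 0 ≤ n * θ ^ 2 := by positivity
    have near0 := abs_spectral_sub_gaussBump_le h0 h1 m hn rfl
    have near2 := abs_spectral''_sub_gaussBump''_le h0 h1 m hn rfl
    obtain ⟨far0, -, far2⟩ := abs_gaussBump_far_le (n := m + 3) hφ rfl (by omega)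
    rw [← hn] at far0 far2
    have bX := bB _ hX0
    have bY := (bB _ (hX0.trans hXY)).trans
      (div_le_div_of_nonneg_left hB.le (by positivity) (pow_le_pow_left₀ (by positivity)
        (add_le_add_right hXY 1) 1))
    rw [pow_one] at bX bY
    have p0 : 0 < 1 / (1 + n * θ ^ 2) := by positivity
    constructor
    · rw [remainder]
      refine (abs_sub _ _).trans ((add_le_add near0 far0).trans ?_)
      calc _ ≤ (3 * Real.exp 4 + 2) / n ^ 2 * (B / (1 + n * θ ^ 2))
            + 1 / n ^ 2 * (B / (1 + n * θ ^ 2)) := by gcongr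
        _ = (3 * Real.exp 4 + 3) * B / n ^ 2 * (1 / (1 + n * θ ^ 2)) := by ring
        _ ≤ _ := by
          have := Real.exp_pos 4
          gcongr <;> norm_num
    · rw [remainder'']
      refine (abs_sub _ _).trans ((add_le_add near2 far2).trans ?_)
      calc _ ≤ (100 * Real.exp 4 + 100) / n * (B / (1 + n * θ ^ 2))
            + 8 / n * (B / (1 + n * θ ^ 2)) := by gcongr
        _ = _ := by ring
  intro θ h0 h1
  have q1 : 0 < 1 / (1 + n * θ ^ 2) := by positivity
  have q2 : 0 < 1 / (1 + n * (Real.pi - θ) ^ 2) := by positivity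
  have c1 : 0 ≤ (100 * Real.exp 4 + 108) * B / n ^ 2 := by positivity
  have c2 : 0 ≤ (100 * Real.exp 4 + 108) * B / n := by positivity
  rcases le_total θ (Real.pi / 2) with h | h
  · obtain ⟨a, b⟩ := half θ h0 h
    exact ⟨a.trans (mul_le_mul_of_nonneg_left (by linarith) c1),
      b.trans (mul_le_mul_of_nonneg_left (by linarith) c2)⟩
  · obtain ⟨a, b⟩ := half (Real.pi - θ) (by linarith) (by linarith)
    rw [remainder_pi_sub] at a
    rw [remainder''_pi_sub] at b
    exact ⟨a.trans (mul_le_mul_of_nonneg_left (by linarith) c1),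
      b.trans (mul_le_mul_of_nonneg_left (by linarith) c2)⟩

end MultiEdgeTree

/-! ### Trapezoidal sums of the spectral density -/

/-- The trapezoidal rule with `N` panels on `[0, π]`. -/
noncomputable def trapPi (N : ℕ) (f : ℝ → ℝ) : ℝ :=
  Real.pi / N * (∑ j ∈ Finset.range N, f ((j + 1) * (Real.pi / N)) + (f 0 - f Real.pi) / 2)

theorem abs_trapPi_sub_integral_le {f f' f'' : ℝ → ℝ} (hf : ∀ x, HasDerivAt f (f' x) x)
    (hf' : ∀ x, HasDerivAt f' (f'' x) x) (hc : Continuous f'') {N : ℕ} (hN : 1 ≤ N) :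
    |trapPi N f - ∫ x in (0 : ℝ)..Real.pi, f x| ≤
      Real.pi ^ 2 / N ^ 2 * ∫ x in (0 : ℝ)..Real.pi, |f'' x| := by
  have hN0 : (0 : ℝ) < N := by exact_mod_cast hN
  have hh : 0 ≤ Real.pi / N := by positivity
  have h := abs_trapezoid_sub_integral_le hf hf' hc 0 hh N
  simp only [zero_add, mul_div_cancel₀ Real.pi hN0.ne'] at h
  refine h.trans ?_
  have h0 : 0 ≤ ∫ x in (0 : ℝ)..Real.pi, |f'' x| :=
    intervalIntegral.integral_nonneg Real.pi_pos.le fun _ _ => abs_nonneg _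
  rw [div_pow]
  refine mul_le_mul_of_nonneg_right ?_ h0
  exact div_le_self (by positivity) (by norm_num)

theorem tendsto_trapPi {f f' f'' : ℝ → ℝ} (hf : ∀ x, HasDerivAt f (f' x) x)
    (hf' : ∀ x, HasDerivAt f' (f'' x) x) (hc : Continuous f'') :
    Tendsto (fun N => trapPi N f) atTop (nhds (∫ x in (0 : ℝ)..Real.pi, f x)) := by
  rw [tendsto_iff_norm_sub_tendsto_zero]
  have h0 : Tendsto (fun N : ℕ => Real.pi ^ 2 / (N : ℝ) ^ 2 * ∫ x in (0 : ℝ)..Real.pi, |f'' x|)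
      atTop (nhds 0) := by
    have h1 : Tendsto (fun N : ℕ => Real.pi ^ 2 / (N : ℝ) ^ 2) atTop (nhds 0) :=
      Tendsto.div_atTop tendsto_const_nhds
        ((tendsto_pow_atTop two_ne_zero).comp tendsto_natCast_atTop_atTop)
    simpa using h1.mul_const (∫ x in (0 : ℝ)..Real.pi, |f'' x|)
  refine squeeze_zero' (Eventually.of_forall fun _ => norm_nonneg _) ?_ h0
  filter_upwards [eventually_ge_atTop 1] with N hN
  exact abs_trapPi_sub_integral_le hf hf' hc hN

theorem integral_one_div_one_add_mul_sq_le {c L : ℝ} (hc : 0 < c) :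
    ∫ x in (0 : ℝ)..L, 1 / (1 + (c * x) ^ 2) ≤ Real.pi / c := by
  have h := intervalIntegral.integral_comp_mul_left (a := 0) (b := L)
    (fun x : ℝ => (1 + x ^ 2)⁻¹) hc.ne'
  simp only [one_div]
  rw [h, integral_inv_one_add_sq, mul_zero, Real.arctan_zero, sub_zero, smul_eq_mul,
    inv_mul_eq_div]
  have := Real.arctan_lt_pi_div_two (c * L)
  have := Real.pi_pos
  gcongr
  linarith

theorem sum_one_div_one_add_sq_div_le {r : ℝ} (hr : 0 < r) (M : ℕ) :
    ∑ j ∈ Finset.range M, 1 / (1 + (((j : ℝ) + 1) / r) ^ 2) ≤ Real.pi * r := by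
  have hanti : AntitoneOn (fun x : ℝ => 1 / (1 + (r⁻¹ * x) ^ 2)) (Set.Icc 0 (0 + (M : ℝ))) := by
    intro x hx y hy hxy
    have h0 := hx.1
    have hr' := inv_pos.2 hr
    have : r⁻¹ * x ≤ r⁻¹ * y := by gcongr
    have h1 : (r⁻¹ * x) ^ 2 ≤ (r⁻¹ * y) ^ 2 := pow_le_pow_left₀ (by positivity) this 2
    exact one_div_le_one_div_of_le (by positivity) (by linarith)
  have h := hanti.sum_le_integral.trans (integral_one_div_one_add_mul_sq_le (inv_pos.2 hr))
  rw [div_inv_eq_mul] at h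
  refine le_trans (le_of_eq (Finset.sum_congr rfl fun j _ => ?_)) h
  push_cast
  rw [zero_add, inv_mul_eq_div]

namespace MultiEdgeTree

/-- The remainder is small compared with the Gaussian profile also in `L¹`, together with its second
derivative. -/
theorem exists_integral_remainder_le : ∃ C : ℝ, 0 < C ∧ ∀ m : ℕ,
    ∫ θ in (0 : ℝ)..Real.pi, |remainder m θ| ≤ C / (((m + 3 : ℕ) : ℝ) ^ 2 * √((m + 3 : ℕ) : ℝ)) ∧
    ∫ θ in (0 : ℝ)..Real.pi, |remainder'' m θ| ≤ C / (((m + 3 : ℕ) : ℝ) * √((m + 3 : ℕ) : ℝ)) := by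
  obtain ⟨C, hC, hb⟩ := exists_remainder_le
  refine ⟨C * (2 * Real.pi), by positivity, fun m => ?_⟩
  set n : ℝ := ((m + 3 : ℕ) : ℝ) with hn
  have hn0 : 0 < n := by rw [hn]; positivity
  set r := √n with hr
  have hr0 : 0 < r := Real.sqrt_pos.2 hn0
  have hr2 : n = r ^ 2 := (Real.sq_sqrt hn0.le).symm
  have c1 : Continuous fun x : ℝ => 1 / (1 + (r * x) ^ 2) :=
    continuous_const.div (by fun_prop) fun x => by positivity
  have c2 : Continuous fun x : ℝ => 1 / (1 + (r * (Real.pi - x)) ^ 2) :=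
    continuous_const.div (by fun_prop) fun x => by positivity
  have key : ∫ x in (0 : ℝ)..Real.pi, (1 / (1 + (r * x) ^ 2) + 1 / (1 + (r * (Real.pi - x)) ^ 2))
      ≤ 2 * Real.pi / r := by
    rw [intervalIntegral.integral_add (c1.intervalIntegrable _ _) (c2.intervalIntegrable _ _),
      intervalIntegral.integral_comp_sub_left (fun x => 1 / (1 + (r * x) ^ 2)), sub_self, sub_zero]
    have := integral_one_div_one_add_mul_sq_le (L := Real.pi) hr0
    calc _ ≤ Real.pi / r + Real.pi / r := add_le_add this this
      _ = _ := by ring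
  have e : ∀ x : ℝ, 1 / (1 + n * x ^ 2) + 1 / (1 + n * (Real.pi - x) ^ 2)
      = 1 / (1 + (r * x) ^ 2) + 1 / (1 + (r * (Real.pi - x)) ^ 2) := by
    intro x; rw [hr2, mul_pow, mul_pow]
  have crem : Continuous (remainder m) :=
    continuous_iff_continuousAt.2 fun x => (hasDerivAt_remainder m x).continuousAt
  have gen : ∀ (g : ℝ → ℝ) (D : ℝ), Continuous g → 0 ≤ D → (∀ x, 0 ≤ x → x ≤ Real.pi →
      |g x| ≤ D * (1 / (1 + n * x ^ 2) + 1 / (1 + n * (Real.pi - x) ^ 2))) →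
      ∫ x in (0 : ℝ)..Real.pi, |g x| ≤ D * (2 * Real.pi / r) := by
    intro g D hg hD hle
    have c3 : Continuous fun x : ℝ =>
        D * (1 / (1 + (r * x) ^ 2) + 1 / (1 + (r * (Real.pi - x)) ^ 2)) :=
      continuous_const.mul (c1.add c2)
    refine (intervalIntegral.integral_mono_on Real.pi_pos.le (hg.abs.intervalIntegrable _ _)
      (c3.intervalIntegrable _ _) fun x hx =>
        (hle x hx.1 hx.2).trans (le_of_eq (by rw [e]))).trans ?_
    rw [intervalIntegral.integral_const_mul]
    exact mul_le_mul_of_nonneg_left key hD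
  constructor
  · refine (gen _ (C / n ^ 2) crem (by positivity) fun x h0 h1 => (hb m x h0 h1).1).trans
      (le_of_eq ?_)
    field_simp
  · refine (gen _ (C / n) (continuous_remainder'' m) (by positivity)
      fun x h0 h1 => (hb m x h0 h1).2).trans (le_of_eq ?_)
    field_simp

/-- Coarse trapezoidal sums of the remainder are small because the remainder is small at the
nodes. -/
theorem exists_abs_trapPi_remainder_le : ∃ C : ℝ, 0 < C ∧ ∀ m N : ℕ, 1 ≤ N →
    |trapPi N (remainder m)| ≤ C * N / ((m + 3 : ℕ) : ℝ) ^ 3 := by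
  obtain ⟨C, hC, hb⟩ := exists_remainder_le
  obtain ⟨B, hB, bB⟩ := exists_one_add_pow_mul_exp_neg_le 5 0 (c := 1 / 4) (by norm_num)
  refine ⟨Real.pi * (4 * C + B), by positivity, fun m N hN => ?_⟩
  have hN0 : (0 : ℝ) < N := by exact_mod_cast hN
  have hN1 : (1 : ℝ) ≤ N := by exact_mod_cast hN
  have hpi := Real.pi_gt_three
  set n : ℝ := ((m + 3 : ℕ) : ℝ) with hn
  have hn0 : 0 < n := by rw [hn]; positivity
  obtain ⟨K, rfl⟩ : ∃ K, N = K + 1 := ⟨N - 1, by omega⟩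
  set h := Real.pi / ((K + 1 : ℕ) : ℝ) with hh
  have hh0 : 0 < h := by positivity
  have hKh : ((K : ℝ) + 1) * h = Real.pi := by
    rw [hh]; push_cast; field_simp
  have h0 : |remainder m 0| ≤ B / n ^ 3 := by
    have e : remainder m 0 = -gaussBump (m + 3) Real.pi := by
      simp [remainder, spectral, gaussBump]
    rw [e, abs_neg]
    have h1 := (abs_gaussBump_far_le (n := m + 3) (φ := Real.pi) (by nlinarith) rfl (by omega)).2.1
    have h2 := bB (((m + 3 : ℕ) : ℝ) * Real.pi ^ 2) (by positivity)
    rw [pow_zero, div_one] at h2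
    refine h1.trans ?_
    rw [← hn] at h2 ⊢
    calc _ ≤ 1 / n ^ 3 * B := by gcongr
      _ = _ := by ring
  have hpi0 : remainder m Real.pi = remainder m 0 := by
    rw [← remainder_pi_sub, sub_self]
  have hnode : ∀ j ∈ Finset.range K, |remainder m ((j + 1) * h)| ≤
      C / (n ^ 3 * h ^ 2) * (1 / ((j : ℝ) + 1) ^ 2 + 1 / (((K - 1 - j : ℕ) : ℝ) + 1) ^ 2) := by
    intro j hj
    have hjK : j + 1 ≤ K := Finset.mem_range.1 hj
    have hjK' : (j : ℝ) + 1 ≤ K := by exact_mod_cast hjK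
    have e1 : Real.pi - (j + 1) * h = (((K - 1 - j : ℕ) : ℝ) + 1) * h := by
      rw [← hKh, Nat.sub_sub, Nat.cast_sub (by omega)]; push_cast; ring
    have hle : ((j : ℝ) + 1) * h ≤ Real.pi := by rw [← hKh]; gcongr; linarith
    have := (hb m ((j + 1) * h) (by positivity) hle).1
    rw [e1, ← hn] at this
    refine this.trans ?_
    have gen : ∀ x : ℝ, 0 < x → 1 / (1 + n * (x * h) ^ 2) ≤ 1 / (n * h ^ 2) * (1 / x ^ 2) := by
      intro x hx
      rw [one_div_mul_one_div]
      refine one_div_le_one_div_of_le (by positivity) ?_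
      nlinarith
    calc _ ≤ C / n ^ 2 * (1 / (n * h ^ 2) * (1 / ((j : ℝ) + 1) ^ 2)
          + 1 / (n * h ^ 2) * (1 / (((K - 1 - j : ℕ) : ℝ) + 1) ^ 2)) := by
          gcongr
          · exact gen _ (by positivity)
          · exact gen _ (by positivity)
      _ = _ := by field_simp
  have hsum : |∑ j ∈ Finset.range K, remainder m ((j + 1) * h)| ≤ C / (n ^ 3 * h ^ 2) * 4 := by
    refine (Finset.abs_sum_le_sum_abs _ _).trans ((Finset.sum_le_sum hnode).trans ?_)
    rw [← Finset.mul_sum, Finset.sum_add_distrib,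
      Finset.sum_range_reflect (fun j : ℕ => 1 / ((j : ℝ) + 1) ^ 2) K]
    have := sum_one_div_succ_sq_le K
    gcongr
    linarith
  rw [trapPi, Finset.sum_range_succ, hKh, hpi0, sub_self, zero_div, add_zero, ← hh,
    abs_mul, abs_of_pos hh0]
  have hhpi : h ≤ Real.pi := by rw [hh]; exact div_le_self (by linarith) hN1
  calc _ ≤ h * (C / (n ^ 3 * h ^ 2) * 4 + B / n ^ 3) := by
        gcongr
        exact (abs_add_le _ _).trans (add_le_add hsum h0)
    _ = (4 * C * (1 / h) + B * h) / n ^ 3 := by field_simp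
    _ ≤ (4 * C * (Real.pi * (K + 1 : ℕ)) + B * (Real.pi * (K + 1 : ℕ))) / n ^ 3 := by
        have a1 : 1 / h ≤ Real.pi * (K + 1 : ℕ) := by
          rw [hh, one_div_div, div_le_iff₀ (by linarith)]
          nlinarith [mul_pos hN0 (by linarith : 0 < Real.pi)]
        have a2 : h ≤ Real.pi * (K + 1 : ℕ) := hhpi.trans (by nlinarith)
        gcongr
    _ = _ := by ring

/-- The errors of the trapezoidal sums of the remainder are summable over the number of panels,
with a total that is smaller than the main term by a factor `1 / √n`. -/
theorem exists_sum_trapPi_remainder_le : ∃ C : ℝ, 0 < C ∧ ∀ m M : ℕ,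
    ∑ j ∈ Finset.range M, |trapPi (j + 1) (remainder m) - ∫ θ in (0 : ℝ)..Real.pi, remainder m θ|
      ≤ C / ((m + 3 : ℕ) : ℝ) ^ 2 := by
  obtain ⟨A, hA, bA⟩ := exists_integral_remainder_le
  obtain ⟨B, hB, bB⟩ := exists_abs_trapPi_remainder_le
  refine ⟨(2 * (A + B) + 2 * (Real.pi ^ 2 * A)) * Real.pi, by positivity, fun m M => ?_⟩
  obtain ⟨bA0, bA2⟩ := bA m
  have bB' := bB m
  set n : ℝ := ((m + 3 : ℕ) : ℝ) with hn
  have hn0 : 0 < n := by rw [hn]; positivity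
  set r := √n with hr
  have hr0 : 0 < r := Real.sqrt_pos.2 hn0
  have hr2 : n = r ^ 2 := (Real.sq_sqrt hn0.le).symm
  have hI : |∫ θ in (0 : ℝ)..Real.pi, remainder m θ| ≤ A / (n ^ 2 * r) :=
    (intervalIntegral.abs_integral_le_integral_abs Real.pi_pos.le).trans bA0
  have hterm : ∀ j ∈ Finset.range M,
      |trapPi (j + 1) (remainder m) - ∫ θ in (0 : ℝ)..Real.pi, remainder m θ| ≤
      (2 * (A + B) + 2 * (Real.pi ^ 2 * A)) / (n ^ 2 * r) *
        (1 / (1 + (((j : ℝ) + 1) / r) ^ 2)) := by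
    intro j _
    have hc : (((j + 1 : ℕ) : ℝ)) = (j : ℝ) + 1 := by push_cast; ring
    have hx0 : (0 : ℝ) < (j : ℝ) + 1 := by positivity
    -- below `√n` panels both the sum and the integral are small; above, the error estimate applies
    rcases le_total ((j : ℝ) + 1) r with hle | hle
    · have h1 := bB' (j + 1) (by omega)
      rw [hc] at h1
      have h2 : (1 : ℝ) / 2 ≤ 1 / (1 + (((j : ℝ) + 1) / r) ^ 2) := by
        refine one_div_le_one_div_of_le (by positivity) ?_
        have : ((j : ℝ) + 1) / r ≤ 1 := (div_le_one hr0).2 hle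
        have : (((j : ℝ) + 1) / r) ^ 2 ≤ 1 := pow_le_one₀ (by positivity) this
        linarith
      calc _ ≤ B * (j + 1) / n ^ 3 + A / (n ^ 2 * r) := (abs_sub _ _).trans (add_le_add h1 hI)
        _ ≤ B * r / n ^ 3 + A / (n ^ 2 * r) := by gcongr
        _ = (2 * (A + B)) / (n ^ 2 * r) * (1 / 2) := by rw [hr2]; field_simp; ring
        _ ≤ _ := by
          have : 0 < 2 * (Real.pi ^ 2 * A) := by positivity
          gcongr
          linarith
    · have h1 := abs_trapPi_sub_integral_le (hasDerivAt_remainder m) (hasDerivAt_remainder' m)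
        (continuous_remainder'' m) (N := j + 1) (by omega)
      rw [hc] at h1
      have h2 : r ^ 2 / ((j : ℝ) + 1) ^ 2 ≤ 2 * (1 / (1 + (((j : ℝ) + 1) / r) ^ 2)) := by
        rw [mul_one_div, div_le_div_iff₀ (by positivity) (by positivity)]
        have : r ^ 2 ≤ ((j : ℝ) + 1) ^ 2 := pow_le_pow_left₀ hr0.le hle 2
        have e : r ^ 2 * (1 + (((j : ℝ) + 1) / r) ^ 2) = r ^ 2 + ((j : ℝ) + 1) ^ 2 := by
          field_simp
        rw [e]; linarith
      calc _ ≤ Real.pi ^ 2 / ((j : ℝ) + 1) ^ 2 * (A / (n * r)) := h1.trans (by gcongr)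
        _ = Real.pi ^ 2 * A / (n ^ 2 * r) * (r ^ 2 / ((j : ℝ) + 1) ^ 2) := by
          rw [hr2]; field_simp
        _ ≤ Real.pi ^ 2 * A / (n ^ 2 * r) * (2 * (1 / (1 + (((j : ℝ) + 1) / r) ^ 2))) := by gcongr
        _ = 2 * (Real.pi ^ 2 * A) / (n ^ 2 * r) * (1 / (1 + (((j : ℝ) + 1) / r) ^ 2)) := by ring
        _ ≤ _ := by
          have : 0 < 2 * (A + B) := by positivity
          gcongr
          linarith
  refine (Finset.sum_le_sum hterm).trans ?_
  rw [← Finset.mul_sum]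
  calc _ ≤ (2 * (A + B) + 2 * (Real.pi ^ 2 * A)) / (n ^ 2 * r) * (Real.pi * r) := by
        gcongr
        exact sum_one_div_one_add_sq_div_le hr0 M
    _ = _ := by field_simp

end MultiEdgeTree

/-! ### Trapezoidal errors of the Gaussian profile -/

theorem gaussBump_eq {n : ℕ} {R : ℝ} (hR : 0 < R) (hn : R ^ 2 = 4 / 5 * n) (θ : ℝ) :
    gaussBump n θ = 1 / R ^ 2 * bump (R * θ) := by
  have e : -(R * θ) ^ 2 = -(4 / 5 * n * θ ^ 2) := by rw [mul_pow, hn]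
  rw [gaussBump, bump, e]
  field_simp

theorem integral_gaussBump_eq {n : ℕ} {R : ℝ} (hR : 0 < R) (hn : R ^ 2 = 4 / 5 * n) :
    ∫ θ in (0 : ℝ)..Real.pi, gaussBump n θ =
      1 / R ^ 3 * (√Real.pi / 4 - ∫ x in Set.Ioi (R * Real.pi), bump x) := by
  simp only [gaussBump_eq hR hn]
  rw [intervalIntegral.integral_const_mul, intervalIntegral.integral_comp_mul_left bump hR.ne',
    mul_zero, ← integral_Ioi_bump, ← intervalIntegral.integral_interval_add_Ioi (a := 0)
      (b := R * Real.pi) integrable_bump.integrableOn integrable_bump.integrableOn, smul_eq_mul]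
  field_simp
  ring

theorem exists_integral_gaussBump : ∃ C : ℝ, 0 < C ∧ ∀ (n : ℕ) (R : ℝ), 0 < R →
    R ^ 2 = 4 / 5 * n →
    |(∫ θ in (0 : ℝ)..Real.pi, gaussBump n θ) - √Real.pi / (4 * R ^ 3)| ≤ C / R ^ 5 := by
  obtain ⟨C, hC, hb⟩ := exists_bump_le 2
  refine ⟨C * Real.pi, by positivity, fun n R hR hn => ?_⟩
  have hpi := Real.pi_gt_three
  have htail : |∫ x in Set.Ioi (R * Real.pi), bump x| ≤ C / R ^ 2 * Real.pi := by
    have h1 : ∫ x in Set.Ioi (R * Real.pi), C / R ^ 2 * (1 + x ^ 2)⁻¹ ≤ C / R ^ 2 * Real.pi := by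
      rw [integral_const_mul, integral_Ioi_inv_one_add_sq]
      have := Real.neg_pi_div_two_lt_arctan (R * Real.pi)
      gcongr
      linarith
    rw [← Real.norm_eq_abs]
    refine le_trans ?_ h1
    refine norm_integral_le_of_norm_le
      ((integrable_inv_one_add_sq.const_mul _).integrableOn)
      (ae_restrict_of_forall_mem measurableSet_Ioi fun x hx => ?_)
    rw [Real.norm_eq_abs]
    refine (hb x).trans ?_
    have hx' : R * Real.pi < x := hx
    have h2 : R ^ 2 ≤ x ^ 2 := pow_le_pow_left₀ hR.le (by nlinarith) 2
    rw [← div_eq_mul_inv, div_div]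
    refine div_le_div_of_nonneg_left hC.le (by positivity) ?_
    nlinarith [sq_nonneg x]
  have e : (∫ θ in (0 : ℝ)..Real.pi, gaussBump n θ) - √Real.pi / (4 * R ^ 3)
      = -(1 / R ^ 3 * ∫ x in Set.Ioi (R * Real.pi), bump x) := by
    rw [integral_gaussBump_eq hR hn]
    field_simp
    ring
  rw [e, abs_neg, abs_mul, abs_of_pos (by positivity)]
  calc _ ≤ 1 / R ^ 3 * (C / R ^ 2 * Real.pi) := by gcongr
    _ = _ := by field_simp

/-- The errors of the trapezoidal sums of the Gaussian profile on `[0, π]` are rescaled values of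
`latticeDefect`, up to the contribution of `[π, ∞)`. -/
theorem exists_gaussBump_defect : ∃ C : ℝ, 0 < C ∧ ∀ (n : ℕ) (R : ℝ), 1 ≤ R →
    R ^ 2 = 4 / 5 * n → ∀ N : ℕ, 1 ≤ N →
    |(∫ θ in (0 : ℝ)..Real.pi, gaussBump n θ) - trapPi N (gaussBump n)
      - √Real.pi / (4 * R ^ 3) * latticeDefect (N * (1 / (Real.pi * R)))| ≤
      C / R ^ 4 * (1 / (N : ℝ) ^ 2) := by
  obtain ⟨C, hC, hb⟩ := exists_trapezoid_bump
  obtain ⟨D, hD, bD⟩ := exists_bump_le 1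
  refine ⟨C, hC, fun n R hR1 hn N hN => ?_⟩
  have hR : 0 < R := by linarith
  have hN0 : (0 : ℝ) < N := by exact_mod_cast hN
  have hpi := Real.pi_gt_three
  have hpi0 := Real.pi_pos
  have hsq : 0 < √Real.pi := Real.sqrt_pos.2 Real.pi_pos
  set H := R * (Real.pi / N) with hH
  have hH0 : 0 < H := by positivity
  have hNH : R * Real.pi = N * H := by rw [hH]; field_simp
  have hs : Summable fun j : ℕ => bump ((j + 1) * H) := by
    simpa using summable_gauss_lattice (by simpa using bD) 0 le_rfl hH0
  have hsplit := hs.sum_add_tsum_nat_add N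
  have hT := hb (R * Real.pi) H (by positivity) hH0
  have e1 : ∀ j : ℕ, bump (R * Real.pi + (j + 1) * H) = bump (((j + N : ℕ) + 1) * H) := by
    intro j; rw [hNH]; push_cast; ring_nf
  simp only [e1] at hT
  set T := H * (∑' j : ℕ, bump (((j + N : ℕ) + 1) * H) + bump (R * Real.pi) / 2)
    - ∫ x in Set.Ioi (R * Real.pi), bump x with hTdef
  have hinv : ((N : ℝ) * (1 / (Real.pi * R)))⁻¹ = H := by rw [hH]; field_simp
  have hdef : latticeDefect (N * (1 / (Real.pi * R)))
      = 1 - 4 / √Real.pi * (H * ∑' j : ℕ, bump ((j + 1) * H)) := by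
    simp only [latticeDefect, latticeTerm_eq, hinv, tsum_mul_left]
  have htrap : trapPi N (gaussBump n) = H / R ^ 3 *
      (∑ j ∈ Finset.range N, bump ((j + 1) * H) - bump (R * Real.pi) / 2) := by
    have e2 : ∀ j : ℕ, R * (((j : ℝ) + 1) * (Real.pi / N)) = (j + 1) * H := by
      intro j; rw [hH]; ring
    simp only [trapPi, gaussBump_eq hR hn, e2]
    rw [← Finset.mul_sum, hH]
    simp only [mul_zero]
    have : bump 0 = 0 := by simp [bump]
    rw [this]
    field_simp
    ring
  have e : (∫ θ in (0 : ℝ)..Real.pi, gaussBump n θ) - trapPi N (gaussBump n)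
      - √Real.pi / (4 * R ^ 3) * latticeDefect (N * (1 / (Real.pi * R))) = 1 / R ^ 3 * T := by
    rw [integral_gaussBump_eq hR hn, htrap, hdef, ← hsplit, hTdef]
    field_simp
    ring
  rw [e, abs_mul, abs_of_pos (by positivity)]
  have h1 : C * H ^ 2 / (1 + (R * Real.pi) ^ 2) ^ 2 ≤ C * (1 / (R ^ 2 * N ^ 2)) := by
    have h3 : H ^ 2 = R ^ 2 * Real.pi ^ 2 / N ^ 2 := by rw [hH]; field_simp
    rw [mul_div_assoc, h3]
    refine mul_le_mul_of_nonneg_left ?_ hC.le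
    rw [div_div, div_le_div_iff₀ (by positivity) (by positivity)]
    have h4 : (R ^ 2 * Real.pi ^ 2) * R ^ 2 ≤ (1 + (R * Real.pi) ^ 2) ^ 2 := by
      have h5 : R ^ 2 ≤ (R * Real.pi) ^ 2 := pow_le_pow_left₀ hR.le (by nlinarith) 2
      have h6 : R ^ 2 * Real.pi ^ 2 = (R * Real.pi) ^ 2 := by ring
      rw [h6]
      nlinarith [sq_nonneg (R * Real.pi), sq_nonneg R]
    calc _ = ((R ^ 2 * Real.pi ^ 2) * R ^ 2) * N ^ 2 := by ring
      _ ≤ (1 + (R * Real.pi) ^ 2) ^ 2 * N ^ 2 := by gcongr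
      _ = _ := by ring
  calc _ ≤ 1 / R ^ 3 * (C * (1 / (R ^ 2 * N ^ 2))) := by gcongr; exact hT.trans h1
    _ = C / R ^ 5 * (1 / (N : ℝ) ^ 2) := by field_simp
    _ ≤ C / R ^ 4 * (1 / (N : ℝ) ^ 2) := by
      have : R ^ 4 ≤ R ^ 5 := pow_le_pow_right₀ hR1 (by norm_num)
      gcongr

/-! ### The count and the expected height as trapezoidal errors -/

theorem trapPi_reflect {N : ℕ} (hN : 1 ≤ N) (f : ℝ → ℝ) :
    trapPi N (fun θ => f (Real.pi - θ)) = trapPi N f := by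
  have hN0 : (N : ℝ) ≠ 0 := by exact_mod_cast (by omega : N ≠ 0)
  set h := Real.pi / N with hh
  have hNh : (N : ℝ) * h = Real.pi := by rw [hh]; field_simp
  have e1 : ∑ j ∈ Finset.range N, f (Real.pi - (j + 1) * h)
      = ∑ j ∈ Finset.range N, f (j * h) := by
    rw [← Finset.sum_range_reflect]
    refine Finset.sum_congr rfl fun j hj => ?_
    have hj' := Finset.mem_range.1 hj
    congr 1
    rw [← hNh, Nat.sub_sub, Nat.cast_sub (by omega)]
    push_cast
    ring
  have e2 : ∑ j ∈ Finset.range N, f (j * h) + f Real.pi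
      = ∑ j ∈ Finset.range N, f ((j + 1) * h) + f 0 := by
    have a := Finset.sum_range_succ (fun j : ℕ => f (j * h)) N
    have b := Finset.sum_range_succ' (fun j : ℕ => f (j * h)) N
    rw [hNh] at a
    rw [← a, b]
    simp
  simp only [trapPi, ← hh, e1, sub_zero, sub_self]
  rw [eq_sub_of_add_eq e2]
  ring

namespace MultiEdgeTree

theorem trapPi_spectral {N n : ℕ} (hN : 1 ≤ N) :
    trapPi N (spectral n) = Real.pi / N * ∑ j ∈ Finset.range N, spectral n (Real.pi * j / N) := by
  have hN0 : (N : ℝ) ≠ 0 := by exact_mod_cast (by omega : N ≠ 0)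
  have h0 : spectral n 0 = 0 := by simp [spectral]
  have hpi : spectral n Real.pi = 0 := by simp [spectral]
  have a := Finset.sum_range_succ (fun j : ℕ => spectral n (Real.pi * j / N)) N
  have b := Finset.sum_range_succ' (fun j : ℕ => spectral n (Real.pi * j / N)) N
  rw [mul_div_cancel_right₀ _ hN0, hpi, add_zero] at a
  rw [← a, b, trapPi, h0, hpi]
  simp only [Nat.cast_zero, mul_zero, zero_div, h0, sub_zero, add_zero]
  congr 1
  refine Finset.sum_congr rfl fun j _ => ?_
  congr 1
  push_cast
  ring

theorem card_bounded_eq_trapPi {N n : ℕ} (hN : 2 ≤ N) (hn : 1 ≤ n) :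
    ((bounded (N - 2) n).card : ℝ) = 8 * 5 ^ (n - 1) / Real.pi * trapPi N (spectral n) := by
  have hN0 : (N : ℝ) ≠ 0 := by exact_mod_cast (by omega : N ≠ 0)
  rw [card_bounded_eq hN hn, trapPi_spectral (by omega)]
  field_simp

theorem trapPi_one_spectral (n : ℕ) : trapPi 1 (spectral n) = 0 := by
  simp [trapPi, spectral]

/-- The integral of the spectral density for size `m + 3` over a period. -/
noncomputable def spectralMass (m : ℕ) : ℝ := ∫ θ in (0 : ℝ)..Real.pi, spectral (m + 3) θ

/-- For `N ≥ n + 2` the height restriction is void, and the trapezoidal sums converge. -/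
theorem count_eq_spectralMass (m : ℕ) :
    (count (m + 3) : ℝ) = 8 * 5 ^ (m + 2) / Real.pi * spectralMass m := by
  have h1 := (tendsto_trapPi (hasDerivAt_spectral m) (hasDerivAt_spectral' m)
    (continuous_spectral'' m)).const_mul (8 * 5 ^ (m + 2) / Real.pi)
  refine tendsto_nhds_unique (tendsto_const_nhds.congr' ?_) h1
  filter_upwards [eventually_ge_atTop (m + 5)] with N hN
  rw [← card_bounded_of_le (h := N - 2) (by omega), card_bounded_eq_trapPi (by omega) (by omega)]
  rfl

/-- The expected height is governed by the errors of the trapezoidal sums of the spectral density.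
The height bound `h` belongs to `h + 2` panels; the sum with one panel is `0`, which produces the
additional `1`. -/
theorem expectedHeight_eq (m M : ℕ) (hM : m + 3 ≤ M) :
    spectralMass m * (expectedHeight (m + 3) + 1) =
      ∑ j ∈ Finset.range (M + 1), (spectralMass m - trapPi (j + 1) (spectral (m + 3))) := by
  have hκ : 8 * (5 : ℝ) ^ (m + 2) / Real.pi ≠ 0 := by
    have := Real.pi_pos
    positivity
  have h := expectedHeight_mul_count hM
  have e : ∀ j : ℕ, ((bounded j (m + 3)).card : ℝ)
      = 8 * 5 ^ (m + 2) / Real.pi * trapPi (j + 1 + 1) (spectral (m + 3)) := by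
    intro j
    exact card_bounded_eq_trapPi (N := j + 2) (by omega) (by omega)
  simp only [e, count_eq_spectralMass, ← mul_sub] at h
  rw [← Finset.mul_sum] at h
  rw [Finset.sum_range_succ', zero_add, trapPi_one_spectral, sub_zero]
  refine mul_left_cancel₀ hκ ?_
  linear_combination h

theorem spectral_eq (m : ℕ) (θ : ℝ) : spectral (m + 3) θ =
    remainder m θ + gaussBump (m + 3) θ + gaussBump (m + 3) (Real.pi - θ) := by
  rw [remainder]; ring

theorem continuous_gaussBump (n : ℕ) : Continuous (gaussBump n) := by unfold gaussBump; fun_prop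

theorem spectralMass_eq (m : ℕ) : spectralMass m = (∫ θ in (0 : ℝ)..Real.pi, remainder m θ) +
    2 * ∫ θ in (0 : ℝ)..Real.pi, gaussBump (m + 3) θ := by
  have c1 : Continuous (remainder m) :=
    continuous_iff_continuousAt.2 fun x => (hasDerivAt_remainder m x).continuousAt
  have c2 := continuous_gaussBump (m + 3)
  have c3 : Continuous fun θ => gaussBump (m + 3) (Real.pi - θ) := by fun_prop
  have c12 : Continuous fun θ => remainder m θ + gaussBump (m + 3) θ := c1.add c2
  simp only [spectralMass, spectral_eq]
  rw [intervalIntegral.integral_add (c12.intervalIntegrable _ _) (c3.intervalIntegrable _ _),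
    intervalIntegral.integral_add (c1.intervalIntegrable _ _) (c2.intervalIntegrable _ _),
    intervalIntegral.integral_comp_sub_left (fun θ => gaussBump (m + 3) θ), sub_self, sub_zero]
  ring

theorem trapPi_spectral_eq (m : ℕ) {N : ℕ} (hN : 1 ≤ N) : trapPi N (spectral (m + 3)) =
    trapPi N (remainder m) + 2 * trapPi N (gaussBump (m + 3)) := by
  have h := trapPi_reflect hN (gaussBump (m + 3))
  have e : trapPi N (spectral (m + 3)) = trapPi N (remainder m) + trapPi N (gaussBump (m + 3))
      + trapPi N (fun θ => gaussBump (m + 3) (Real.pi - θ)) := by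
    simp only [trapPi, spectral_eq, Finset.sum_add_distrib]
    ring
  rw [e, h]
  ring

/-- The scale `√(4n/5)` of the lattice sums that belong to size `n`. -/
noncomputable def heightScale (n : ℕ) : ℝ := √(4 / 5 * n)

theorem heightScale_sq (n : ℕ) : heightScale n ^ 2 = 4 / 5 * n := Real.sq_sqrt (by positivity)

theorem one_le_heightScale (m : ℕ) : 1 ≤ heightScale (m + 3) := by
  rw [heightScale, Real.one_le_sqrt]
  push_cast
  linarith [Nat.cast_nonneg (α := ℝ) m]

/-- The spectral mass is that of the two Gaussian profiles, up to a relative error `O(1 / n)`. -/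
theorem exists_spectralMass : ∃ C : ℝ, 0 < C ∧ ∀ m : ℕ,
    |spectralMass m - √Real.pi / (2 * heightScale (m + 3) ^ 3)| ≤ C / heightScale (m + 3) ^ 5 := by
  obtain ⟨A, hA, bA⟩ := exists_integral_remainder_le
  obtain ⟨B, hB, bB⟩ := exists_integral_gaussBump
  refine ⟨A + 2 * B, by positivity, fun m => ?_⟩
  set R := heightScale (m + 3) with hR
  have hR1 : 1 ≤ R := one_le_heightScale m
  have hR0 : 0 < R := by linarith
  have hR2 : R ^ 2 = 4 / 5 * (m + 3 : ℕ) := heightScale_sq _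
  have h1 := bB (m + 3) R hR0 hR2
  have h2 := (intervalIntegral.abs_integral_le_integral_abs Real.pi_pos.le).trans (bA m).1
  set n : ℝ := ((m + 3 : ℕ) : ℝ) with hn
  have hn0 : 0 < n := by rw [hn]; positivity
  have h3 : A / (n ^ 2 * √n) ≤ A / R ^ 5 := by
    refine div_le_div_of_nonneg_left hA.le (by positivity) ?_
    have hRn : R ^ 2 ≤ n := by linarith
    have hRs : R ≤ √n := Real.le_sqrt_of_sq_le hRn
    calc R ^ 5 = (R ^ 2) ^ 2 * R := by ring
      _ ≤ n ^ 2 * √n := by gcongr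
  rw [spectralMass_eq]
  set a := ∫ θ in (0 : ℝ)..Real.pi, remainder m θ
  set b := ∫ θ in (0 : ℝ)..Real.pi, gaussBump (m + 3) θ
  have e : a + 2 * b - √Real.pi / (2 * R ^ 3) = a + 2 * (b - √Real.pi / (4 * R ^ 3)) := by
    field_simp
    ring
  rw [e]
  refine (abs_add_le _ _).trans ?_
  rw [abs_mul, abs_of_pos (by norm_num : (0 : ℝ) < 2), add_div, mul_div_assoc]
  linarith

end MultiEdgeTree

/-! ### The asymptotic expansions -/

namespace MultiEdgeTree

/-- The numerator of the expected height. Its main term has the order `1 / n`, the error the order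
`1 / n ^ 2`. -/
theorem exists_spectralMass_mul_expectedHeight : ∃ C : ℝ, 0 < C ∧ ∀ m : ℕ,
    |spectralMass m * (expectedHeight (m + 3) + 1) - √Real.pi / (2 * heightScale (m + 3) ^ 3) *
      (√Real.pi * heightScale (m + 3) - 1 / 2)| ≤ C / heightScale (m + 3) ^ 4 := by
  obtain ⟨A, hA, bA⟩ := exists_sum_trapPi_remainder_le
  obtain ⟨B, hB, bB⟩ := exists_gaussBump_defect
  obtain ⟨D, hD, bD⟩ := exists_sum_latticeDefect
  have hsq : 0 < √Real.pi := Real.sqrt_pos.2 Real.pi_pos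
  have hpi0 := Real.pi_pos
  refine ⟨A + 2 * (B * 2) + √Real.pi / 2 * (D * (1 / Real.pi + 2 * Real.pi ^ 2)), by positivity,
    fun m => ?_⟩
  set R := heightScale (m + 3) with hR
  have hR1 : 1 ≤ R := one_le_heightScale m
  have hR0 : 0 < R := by linarith
  have hR2 : R ^ 2 = 4 / 5 * (m + 3 : ℕ) := heightScale_sq _
  -- enough terms for the truncation errors to be negligible
  obtain ⟨M, hMdef⟩ : ∃ M, M + 1 = (m + 3) ^ 2 := ⟨(m + 3) ^ 2 - 1, by
    have : 0 < (m + 3) ^ 2 := by positivity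
    omega⟩
  have hM : m + 3 ≤ M := by nlinarith
  have h1 := expectedHeight_eq m M hM
  have h2 := bA m (M + 1)
  have h4 := bD (1 / (Real.pi * R)) (by positivity) (M + 1) (by omega)
  have hMR : R ^ 4 ≤ ((M + 1 : ℕ) : ℝ) := by
    rw [hMdef]
    push_cast at hR2 ⊢
    have : R ^ 2 ≤ (m : ℝ) + 3 := by rw [hR2]; linarith [Nat.cast_nonneg (α := ℝ) m]
    calc R ^ 4 = (R ^ 2) ^ 2 := by ring
      _ ≤ ((m : ℝ) + 3) ^ 2 := by gcongr
  have hRn : R ^ 4 ≤ ((m + 3 : ℕ) : ℝ) ^ 2 := by rw [hMdef] at hMR; exact_mod_cast hMR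
  have h2' : A / ((m + 3 : ℕ) : ℝ) ^ 2 ≤ A / R ^ 4 :=
    div_le_div_of_nonneg_left hA.le (by positivity) hRn
  -- the contributions of the remainder, of the tails and of the lattice sum
  set I := √Real.pi / (4 * R ^ 3) with hI
  set e₀ := ∫ θ in (0 : ℝ)..Real.pi, remainder m θ with he0
  set g₀ := ∫ θ in (0 : ℝ)..Real.pi, gaussBump (m + 3) θ with hg0
  set S₁ := ∑ j ∈ Finset.range (M + 1), (trapPi (j + 1) (remainder m) - e₀) with hS1
  set S₂ := ∑ j ∈ Finset.range (M + 1), (g₀ - trapPi (j + 1) (gaussBump (m + 3))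
      - I * latticeDefect ((j + 1 : ℕ) * (1 / (Real.pi * R)))) with hS2
  set S₃ := ∑ j ∈ Finset.range (M + 1), latticeDefect ((j + 1) * (1 / (Real.pi * R))) with hS3
  have b1 : |S₁| ≤ A / R ^ 4 := (Finset.abs_sum_le_sum_abs _ _).trans (h2.trans h2')
  have b2 : |S₂| ≤ B / R ^ 4 * 2 := by
    refine (Finset.abs_sum_le_sum_abs _ _).trans ((Finset.sum_le_sum fun j _ =>
      bB (m + 3) R hR1 hR2 (j + 1) (by omega)).trans ?_)
    rw [← Finset.mul_sum]
    have := sum_one_div_succ_sq_le (M + 1)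
    push_cast
    gcongr
  have b3 : |S₃ - (√Real.pi * R - 1 / 2)| ≤ D * (1 / Real.pi + 2 * Real.pi ^ 2) / R := by
    have e3 : 1 / (1 / (Real.pi * R) * √Real.pi) = √Real.pi * R := by
      have : Real.pi = √Real.pi ^ 2 := (Real.sq_sqrt hpi0.le).symm
      field_simp
      exact this
    rw [e3] at h4
    refine h4.trans ?_
    have q1 : 1 / (((M + 1 : ℕ) : ℝ) * (1 / (Real.pi * R))) ^ 2 ≤ Real.pi ^ 2 / R := by
      have : 1 / (((M + 1 : ℕ) : ℝ) * (1 / (Real.pi * R))) ^ 2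
          = Real.pi ^ 2 * R ^ 2 / ((M + 1 : ℕ) : ℝ) ^ 2 := by field_simp
      rw [this, div_le_div_iff₀ (by positivity) hR0]
      have h5 : (R ^ 4) ^ 2 ≤ ((M + 1 : ℕ) : ℝ) ^ 2 := pow_le_pow_left₀ (by positivity) hMR 2
      have h6 : R ^ 3 ≤ (R ^ 4) ^ 2 := by
        rw [← pow_mul]; exact pow_le_pow_right₀ hR1 (by norm_num)
      calc _ = Real.pi ^ 2 * R ^ 3 := by ring
        _ ≤ _ := by gcongr; exact h6.trans h5
    have q2 : 1 / (((M + 1 : ℕ) : ℝ) * (1 / (Real.pi * R)) ^ 2) ≤ Real.pi ^ 2 / R := by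
      have : 1 / (((M + 1 : ℕ) : ℝ) * (1 / (Real.pi * R)) ^ 2)
          = Real.pi ^ 2 * R ^ 2 / ((M + 1 : ℕ) : ℝ) := by field_simp
      rw [this, div_le_div_iff₀ (by positivity) hR0]
      have h6 : R ^ 3 ≤ R ^ 4 := pow_le_pow_right₀ hR1 (by norm_num)
      calc _ = Real.pi ^ 2 * R ^ 3 := by ring
        _ ≤ _ := by gcongr; exact h6.trans hMR
    calc _ ≤ D * (1 / (Real.pi * R) + Real.pi ^ 2 / R + Real.pi ^ 2 / R) := by gcongr
      _ = _ := by field_simp; ring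
  have e : spectralMass m * (expectedHeight (m + 3) + 1) - √Real.pi / (2 * R ^ 3) *
      (√Real.pi * R - 1 / 2) = -S₁ + 2 * S₂ + 2 * I * (S₃ - (√Real.pi * R - 1 / 2)) := by
    have e1 : spectralMass m * (expectedHeight (m + 3) + 1) = -S₁ + 2 * S₂ + 2 * I * S₃ := by
      rw [h1, hS1, hS2, hS3, Finset.mul_sum, Finset.mul_sum, ← Finset.sum_neg_distrib,
        ← Finset.sum_add_distrib, ← Finset.sum_add_distrib]
      refine Finset.sum_congr rfl fun j _ => ?_
      rw [spectralMass_eq, trapPi_spectral_eq m (by omega)]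
      push_cast
      ring
    have e2 : √Real.pi / (2 * R ^ 3) = 2 * I := by rw [hI]; field_simp; norm_num
    rw [e1, e2]; ring
  rw [e]
  have hI0 : 0 < I := by positivity
  refine (abs_add_three _ _ _).trans ?_
  rw [abs_neg, abs_mul, abs_mul (2 * I), abs_of_pos (by norm_num : (0 : ℝ) < 2),
    abs_of_pos (by positivity : 0 < 2 * I)]
  calc _ ≤ A / R ^ 4 + 2 * (B / R ^ 4 * 2)
        + 2 * I * (D * (1 / Real.pi + 2 * Real.pi ^ 2) / R) := by gcongr
    _ = _ := by rw [hI]; field_simp; ring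

/-- The expansion of the expected height in terms of the scale, after division by the spectral
mass. -/
theorem exists_abs_expectedHeight_sub_le : ∃ C : ℝ, 0 < C ∧ ∀ᶠ m : ℕ in atTop,
    |expectedHeight (m + 3) + 1 - (√Real.pi * heightScale (m + 3) - 1 / 2)| ≤
      C / heightScale (m + 3) := by
  obtain ⟨A, hA, bA⟩ := exists_spectralMass
  obtain ⟨B, hB, bB⟩ := exists_spectralMass_mul_expectedHeight
  have hsq : 0 < √Real.pi := Real.sqrt_pos.2 Real.pi_pos
  refine ⟨(B + (√Real.pi + 1) * A) * (4 / √Real.pi), by positivity, ?_⟩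
  have hlarge : ∀ᶠ m : ℕ in atTop, 4 * A / √Real.pi ≤ heightScale (m + 3) ^ 2 := by
    filter_upwards [(tendsto_natCast_atTop_atTop (R := ℝ)).eventually_ge_atTop
      (5 / 4 * (4 * A / √Real.pi))] with m hm
    rw [heightScale_sq]
    push_cast
    linarith
  filter_upwards [hlarge] with m hm
  have h1 := bA m
  have h2 := bB m
  set R := heightScale (m + 3) with hR
  have hR1 : 1 ≤ R := one_le_heightScale m
  have hR0 : 0 < R := by linarith
  set L := √Real.pi * R - 1 / 2 with hL
  set E := expectedHeight (m + 3) + 1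
  set J := spectralMass m
  have hJ : √Real.pi / (4 * R ^ 3) ≤ J := by
    have h3 : A / R ^ 5 ≤ √Real.pi / (4 * R ^ 3) := by
      rw [div_le_iff₀ hsq] at hm
      rw [div_le_div_iff₀ (by positivity) (by positivity)]
      calc A * (4 * R ^ 3) = 4 * A * R ^ 3 := by ring
        _ ≤ R ^ 2 * √Real.pi * R ^ 3 := by gcongr
        _ = _ := by ring
    have h4 : √Real.pi / (2 * R ^ 3) = 2 * (√Real.pi / (4 * R ^ 3)) := by field_simp; norm_num
    have := (abs_le.1 h1).1
    linarith
  have hJ0 : 0 < J := lt_of_lt_of_le (by positivity) hJ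
  have hLabs : |L| ≤ (√Real.pi + 1) * R := by
    rw [abs_le]; constructor <;> nlinarith
  have h5 : |J * (E - L)| ≤ (B + (√Real.pi + 1) * A) / R ^ 4 := by
    have e : J * (E - L) = (J * E - √Real.pi / (2 * R ^ 3) * L)
        - (J - √Real.pi / (2 * R ^ 3)) * L := by ring
    rw [e]
    refine (abs_sub _ _).trans ?_
    rw [abs_mul (J - _)]
    calc _ ≤ B / R ^ 4 + A / R ^ 5 * ((√Real.pi + 1) * R) := by gcongr
      _ = _ := by field_simp
  rw [abs_mul, abs_of_pos hJ0] at h5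
  have h6 : √Real.pi / (4 * R ^ 3) * |E - L| ≤ (B + (√Real.pi + 1) * A) / R ^ 4 :=
    (mul_le_mul_of_nonneg_right hJ (abs_nonneg _)).trans h5
  have h7 : |E - L| = 4 * R ^ 3 / √Real.pi * (√Real.pi / (4 * R ^ 3) * |E - L|) := by field_simp
  rw [h7]
  calc _ ≤ 4 * R ^ 3 / √Real.pi * ((B + (√Real.pi + 1) * A) / R ^ 4) := by gcongr
    _ = _ := by field_simp

theorem sqrt_pi_mul_heightScale (n : ℕ) :
    √Real.pi * heightScale n = 2 / √5 * √(Real.pi * n) := by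
  have h4 : √(4 / 5 : ℝ) = 2 / √5 := by
    rw [Real.sqrt_div (by norm_num), show (4 : ℝ) = 2 ^ 2 by norm_num,
      Real.sqrt_sq (by norm_num)]
  rw [heightScale, Real.sqrt_mul (by norm_num), Real.sqrt_mul Real.pi_pos.le, h4]
  ring

/-- The leading term of `count n` in terms of the scale. -/
theorem leading_count_eq (m : ℕ) :
    (5 : ℝ) ^ (((m + 3 : ℕ) : ℝ) + 1 / 2) / (2 * √(Real.pi * ((m + 3 : ℕ) : ℝ) ^ 3)) =
      8 * 5 ^ (m + 2) / Real.pi * (√Real.pi / (2 * heightScale (m + 3) ^ 3)) := by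
  set n : ℝ := ((m + 3 : ℕ) : ℝ) with hn
  have hn0 : 0 < n := by rw [hn]; positivity
  have hpi0 := Real.pi_pos
  have h5 : (5 : ℝ) ^ (n + 1 / 2) = 5 ^ (m + 3) * √5 := by
    rw [Real.rpow_add (by norm_num), hn, Real.rpow_natCast, Real.sqrt_eq_rpow]
  have hs : √(Real.pi * n ^ 3) = √Real.pi * (√n) ^ 3 := by
    rw [Real.sqrt_mul hpi0.le]
    congr 1
    rw [Real.sqrt_eq_iff_mul_self_eq (by positivity) (by positivity)]
    symm
    calc √n ^ 3 * √n ^ 3 = (√n ^ 2) ^ 3 := by ring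
      _ = n ^ 3 := by rw [Real.sq_sqrt hn0.le]
  have hR : heightScale (m + 3) = 2 / √5 * √n := by
    rw [heightScale, ← hn, Real.sqrt_mul (by norm_num), Real.sqrt_div (by norm_num),
      show (4 : ℝ) = 2 ^ 2 by norm_num, Real.sqrt_sq (by norm_num)]
  have e5 : √(5 : ℝ) ^ 2 = 5 := Real.sq_sqrt (by norm_num)
  have epi : √Real.pi ^ 2 = Real.pi := Real.sq_sqrt hpi0.le
  have hsn : 0 < √n := Real.sqrt_pos.2 hn0
  have hsp : 0 < √Real.pi := Real.sqrt_pos.2 hpi0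
  have hs5 : 0 < √(5 : ℝ) := Real.sqrt_pos.2 (by norm_num)
  rw [h5, hs, hR, ← epi]
  simp only [Real.sqrt_sq hsp.le]
  field_simp
  rw [e5]
  ring

end MultiEdgeTree

theorem mainTheorem1 :
    ((fun n : ℕ => MultiEdgeTree.expectedHeight n -
        (2 / Real.sqrt 5 * Real.sqrt (Real.pi * (n : ℝ)) - 3 / 2))
      =O[atTop] (fun n : ℕ => 1 / Real.sqrt (n : ℝ))) ∧
    (∃ ε : ℕ → ℝ, ε =O[atTop] (fun n : ℕ => 1 / (n : ℝ)) ∧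
      ∀ n : ℕ, 1 ≤ n →
        (MultiEdgeTree.count n : ℝ) =
          (5 : ℝ) ^ ((n : ℝ) + 1 / 2) / (2 * Real.sqrt (Real.pi * (n : ℝ) ^ 3)) * (1 + ε n)) := by
  have hpi0 := Real.pi_pos
  have hsp : 0 < √Real.pi := Real.sqrt_pos.2 hpi0
  constructor
  · obtain ⟨C, hC, hb⟩ := MultiEdgeTree.exists_abs_expectedHeight_sub_le
    refine IsBigO.of_bound (2 * C) ?_
    rw [← map_add_atTop_eq_nat 3, eventually_map]
    filter_upwards [hb] with m hm
    have hR1 := MultiEdgeTree.one_le_heightScale m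
    rw [MultiEdgeTree.sqrt_pi_mul_heightScale] at hm
    have hn0 : (0 : ℝ) < ((m + 3 : ℕ) : ℝ) := by positivity
    have hsn := Real.sqrt_pos.2 hn0
    have hle : √((m + 3 : ℕ) : ℝ) ≤ 2 * MultiEdgeTree.heightScale (m + 3) := by
      refine Real.sqrt_le_iff.2 ⟨by linarith, ?_⟩
      rw [mul_pow, MultiEdgeTree.heightScale_sq]
      linarith
    rw [Real.norm_eq_abs, Real.norm_eq_abs, abs_of_pos (one_div_pos.2 hsn), mul_one_div]
    have e : MultiEdgeTree.expectedHeight (m + 3) -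
        (2 / √5 * √(Real.pi * ((m + 3 : ℕ) : ℝ)) - 3 / 2) = MultiEdgeTree.expectedHeight (m + 3) + 1
        - (2 / √5 * √(Real.pi * ((m + 3 : ℕ) : ℝ)) - 1 / 2) := by ring
    rw [e]
    refine hm.trans ?_
    rw [div_le_div_iff₀ (by linarith) hsn]
    nlinarith
  · obtain ⟨C, hC, hb⟩ := MultiEdgeTree.exists_spectralMass
    -- the relative error is determined by the claim, the leading term being nonzero
    refine ⟨fun n => MultiEdgeTree.count n /
      ((5 : ℝ) ^ ((n : ℝ) + 1 / 2) / (2 * √(Real.pi * (n : ℝ) ^ 3))) - 1, ?_, ?_⟩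
    · refine IsBigO.of_bound (2 * C / √Real.pi * (5 / 4)) ?_
      rw [← map_add_atTop_eq_nat 3, eventually_map]
      refine Eventually.of_forall fun m => ?_
      have hR1 := MultiEdgeTree.one_le_heightScale m
      have hR2 := MultiEdgeTree.heightScale_sq (m + 3)
      have h1 := hb m
      rw [MultiEdgeTree.leading_count_eq, MultiEdgeTree.count_eq_spectralMass]
      set R := MultiEdgeTree.heightScale (m + 3)
      set J := MultiEdgeTree.spectralMass m
      have hR0 : 0 < R := by linarith
      have hn0 : (0 : ℝ) < ((m + 3 : ℕ) : ℝ) := by positivity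
      have e : 8 * 5 ^ (m + 2) / Real.pi * J /
          (8 * 5 ^ (m + 2) / Real.pi * (√Real.pi / (2 * R ^ 3))) - 1
          = 2 * R ^ 3 / √Real.pi * (J - √Real.pi / (2 * R ^ 3)) := by
        field_simp
      rw [e, Real.norm_eq_abs, Real.norm_eq_abs, abs_of_pos (one_div_pos.2 hn0), abs_mul,
        abs_of_pos (by positivity)]
      calc _ ≤ 2 * R ^ 3 / √Real.pi * (C / R ^ 5) := by gcongr
        _ = 2 * C / √Real.pi * (1 / R ^ 2) := by field_simp
        _ = _ := by rw [hR2]; field_simp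
    · intro n hn
      have hn0 : (0 : ℝ) < n := by exact_mod_cast hn
      have h5 : (0 : ℝ) < 5 ^ ((n : ℝ) + 1 / 2) := Real.rpow_pos_of_pos (by norm_num) _
      have hs : 0 < √(Real.pi * (n : ℝ) ^ 3) := Real.sqrt_pos.2 (by positivity)
      field_simp
      ring
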